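/- Let $A=x^2+y^2+z^2$, and let $\mathrm D\subset\mathbb P^3$ be a Darboux cyclide of degree four, that is, the surface $F=0$ for an absolutely irreducible polynomial $F=A^2+2ALw+Qw^2$ with $L\in\mathbb R[x,y,z]$ a linear form and $Q\in\mathbb R[x,y,z,w]$ a quadratic form. Assume that the absolute conic $\mathrm C_A:\ A=w=0$ is a cuspidal curve of $\mathrm D$: it lies in the singular locus of $\mathrm D$, and a generic plane section of $\mathrm D$ has a cusp at every point where the plane meets $\mathrm C_A$. Let $c\in\mathbb R^3$ be a generic camera position (that is, $P(c)\ne0$ for a suitable nonzero polynomial $P$ that depends only on $F$), translate $\mathrm D$ so that $c$ moves to $o=(0:0:0:1)$, and denote the translated surface and its equation again by $\mathrm D$ and $F$. Then $o\notin \mathrm D$. Let $\pi:(x:y:z:w)\mapsto(x:y:z)$ be the projection from $o$, let $\mathrm R$ be the contour, that is, the scheme $F=\partial_wF=0$, let $\mathrm R_1$ be the Zariski closure of $\mathrm R\setminus \mathrm C_A$ (the component of the contour besides $\mathrm C_A$), let $\mathrm B$ be the apparent contour, that is, the plane curve (with its scheme structure) defined by the discriminant $U$ of $F$ with respect to $w$,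 and let $\mathrm C_E\subset\mathbb P^2$ be the conic $A=0$. Then $U=U_1A^3$ for a form $U_1\in\mathbb C[x,y,z]$; let $\mathrm B_1$ be the curve $U_1=0$. Let $q=\pi(p)$ be the image of a complex point $p\in \mathrm C_A\cap \mathrm R_1$ such that $\mathrm B_1$ and $\mathrm C_E$ meet tangentially at $q$, i.e. with intersection multiplicity at least $2$. Then this multiplicity is $3$. Let $\mathcal O$ be the local ring of $\mathbb P^2_{\mathbb C}$ at $q$, with maximal ideal $M$; let $E_q=\mathcal O/(U)$ be the local ring of $\mathrm B$ at $q$, and let $F_q$ be the ring of regular functions on $\mathrm R$ defined in neighbourhoods of the points of $\mathrm R$ over $q$, so that $F_q=\mathcal O[w]/(f,\partial_wf)$ for the local equation $f$ of $\mathrm D$. Let $C_q=\{a\in E_q: aF_q\subseteq E_q\}$ be the conductor of $E_q$ in $F_q$, via the homomorphism $E_q\to F_q$ induced by $\pi$. Then the preimage of $C_q$ in $\mathcal O$ is $$\partial(\mathrm{Id}(\mathrm B_1),\mathrm{Id}(\mathrm C_E),-9,M^2),$$ where $\mathrm{Id}(\mathrm B_1)$ and $\mathrm{Id}(\mathrm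 C_E)$ are the ideals of $\mathcal O$ generated by local equations of the two curves, and, for ideals $I,J,K$ of $\mathcal O$ and $\lambda\in\mathbb C$, the mixed jacobian ideal $\partial(I,J,\lambda,K)$ is the ideal generated by all elements $$\frac{\partial(G,H)}{\partial(s,t)}\,G'+\lambda\, G\,\frac{\partial(G',H)}{\partial(s,t)},\qquad G\in I,\ G'\in J,\ H\in K,$$ with $s,t$ any regular system of parameters of $\mathcal O$. -/

import Mathlib

noncomputable section

/-! ### Forms and Darboux cyclides

The homogeneous coordinates of projective 3-space are ordered `(w : x : y : z)`: the variable of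
index `0` is `w`, the variables of index `1, 2, 3` are `x, y, z`. The projection from
`o = (w : x : y : z) = (1 : 0 : 0 : 0)` is `Fin.tail`. -/

/-- The quadratic form `x ^ 2 + y ^ 2 + z ^ 2`; it defines the absolute conic `C_E` of the image
plane. -/
def absoluteForm (R : Type*) [CommRing R] : MvPolynomial (Fin 3) R :=
  ∑ j, MvPolynomial.X j ^ 2

/-- `F` is the equation of a Darboux cyclide of degree four: `F = A ^ 2 + 2 A L w + Q w ^ 2` with
`A = x ^ 2 + y ^ 2 + z ^ 2`, a linear form `L` in `x, y, z` and a quadratic form `Q` in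
`w, x, y, z`, and `F` is absolutely irreducible. -/
def IsDarbouxCyclide (F : MvPolynomial (Fin 4) ℝ) : Prop :=
  (∃ (L : MvPolynomial (Fin 3) ℝ) (Q : MvPolynomial (Fin 4) ℝ),
    L.IsHomogeneous 1 ∧ Q.IsHomogeneous 2 ∧
    F = (MvPolynomial.rename Fin.succ (absoluteForm ℝ)) ^ 2
      + 2 * MvPolynomial.rename Fin.succ (absoluteForm ℝ) * MvPolynomial.rename Fin.succ L
        * MvPolynomial.X 0
      + Q * MvPolynomial.X 0 ^ 2) ∧
  Irreducible (MvPolynomial.map Complex.ofRealHom F)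

/-- The Euclidean absolute conic `C_A : x ^ 2 + y ^ 2 + z ^ 2 = w = 0`. Sets of points of a
projective space are given by the nonzero vectors that represent them. -/
def absoluteConic : Set (Fin 4 → ℂ) :=
  {p | p ≠ 0 ∧ p 0 = 0 ∧ MvPolynomial.eval (Fin.tail p) (absoluteForm ℂ) = 0}

/-! ### Cuspidal curves -/

/-- The plane curve `f = 0` has a cusp at the origin: the origin is a double point with a single
tangent line `ℓ = 0`, and this line meets the curve with multiplicity three. -/
def HasCuspAtOrigin (f : MvPolynomial (Fin 2) ℂ) : Prop :=
  MvPolynomial.homogeneousComponent 0 f = 0 ∧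
  MvPolynomial.homogeneousComponent 1 f = 0 ∧
  ∃ ℓ : MvPolynomial (Fin 2) ℂ, ℓ.IsHomogeneous 1 ∧ ℓ ≠ 0 ∧
    MvPolynomial.homogeneousComponent 2 f = ℓ ^ 2 ∧
    ¬ ℓ ∣ MvPolynomial.homogeneousComponent 3 f

/-- The equation of the section of the surface `F = 0` by the plane spanned by the points
`p, u, v`, in the affine coordinates `(s, t)` centred at `p` that belong to the point
`p + s u + t v`. -/
def planeSection (F : MvPolynomial (Fin 4) ℂ) (p u v : Fin 4 → ℂ) : MvPolynomial (Fin 2) ℂ :=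
  MvPolynomial.aeval (fun k => MvPolynomial.C (p k)
    + MvPolynomial.C (u k) * MvPolynomial.X 0 + MvPolynomial.C (v k) * MvPolynomial.X 1) F

/-- The irreducible curve `S` is a cuspidal curve of the surface `F = 0`: it lies in the singular
locus, and the section by a generic plane `n₀ w + n₁ x + n₂ y + n₃ z = 0` has a cusp at every point
at which the plane meets `S`. Generic means: off the zero set of a nonzero polynomial in the
coefficients of the plane. -/
def IsCuspidalCurve (F : MvPolynomial (Fin 4) ℂ) (S : Set (Fin 4 → ℂ)) : Prop :=
  (∀ p ∈ S, MvPolynomial.eval p F = 0 ∧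
    ∀ k, MvPolynomial.eval p (MvPolynomial.pderiv k F) = 0) ∧
  ∃ H : MvPolynomial (Fin 4) ℂ, H ≠ 0 ∧
    ∀ n : Fin 4 → ℂ, n ≠ 0 → MvPolynomial.eval n H ≠ 0 →
      ∀ p ∈ S, n ⬝ᵥ p = 0 →
        ∀ u v : Fin 4 → ℂ, n ⬝ᵥ u = 0 → n ⬝ᵥ v = 0 → LinearIndependent ℂ ![p, u, v] →
          HasCuspAtOrigin (planeSection F p u v)

/-! ### Contour and apparent contour -/

/-- The centre of projection `o`. -/
def center : Fin 4 → ℂ := Pi.single 0 1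

/-- The complex equation of the surface `F = 0` after the translation that moves the camera
position with Cartesian coordinates `c` to `o`. -/
def viewFrom (c : Fin 3 → ℝ) (F : MvPolynomial (Fin 4) ℝ) : MvPolynomial (Fin 4) ℂ :=
  MvPolynomial.map Complex.ofRealHom
    (MvPolynomial.aeval (Fin.cons (MvPolynomial.X 0)
      (fun j : Fin 3 => MvPolynomial.X j.succ + MvPolynomial.C (c j) * MvPolynomial.X 0) :
        Fin 4 → MvPolynomial (Fin 4) ℝ) F)

/-- The contour `R : G = ∂G/∂w = 0`. -/
def contour (G : MvPolynomial (Fin 4) ℂ) : Set (Fin 4 → ℂ) :=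
  {r | r ≠ 0 ∧ MvPolynomial.eval r G = 0 ∧ MvPolynomial.eval r (MvPolynomial.pderiv 0 G) = 0}

/-- The component `R₁` of the contour besides the absolute conic: the Zariski closure of
`R \ C_A`. -/
def residualContour (G : MvPolynomial (Fin 4) ℂ) : Set (Fin 4 → ℂ) :=
  {p | p ≠ 0 ∧ ∀ H : MvPolynomial (Fin 4) ℂ,
    (∀ r ∈ contour G \ absoluteConic, MvPolynomial.eval r H = 0) → MvPolynomial.eval p H = 0}

/-- `G` as a polynomial in `w` with coefficients in `ℂ[x, y, z]`. -/
def asPolynomialInW (G : MvPolynomial (Fin 4) ℂ) : Polynomial (MvPolynomial (Fin 3) ℂ) :=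
  MvPolynomial.finSuccEquiv ℂ 3 G

/-- The equation of the apparent contour `B`: the discriminant of `G` with respect to `w`. -/
def apparentContour (G : MvPolynomial (Fin 4) ℂ) : MvPolynomial (Fin 3) ℂ :=
  (asPolynomialInW G).discr

/-! ### Local rings of the image plane -/

/-- Restriction to the affine chart of the image plane in which the coordinate of index `i`
is `1`. -/
def dehomogenize (i : Fin 3) : MvPolynomial (Fin 3) ℂ →ₐ[ℂ] MvPolynomial (Fin 2) ℂ :=
  MvPolynomial.aeval (i.insertNth 1 MvPolynomial.X : Fin 3 → MvPolynomial (Fin 2) ℂ)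

/-- The ideal, in the coordinate ring of the chart of index `i`, of the point `q`, which is
represented by a vector with `q i = 1`. -/
def pointIdeal (i : Fin 3) (q : Fin 3 → ℂ) : Ideal (MvPolynomial (Fin 2) ℂ) :=
  RingHom.ker (MvPolynomial.eval (i.removeNth q))

instance pointIdeal_isPrime (i : Fin 3) (q : Fin 3 → ℂ) : (pointIdeal i q).IsPrime :=
  RingHom.ker_isPrime _

/-- The local ring of the projective plane at `q`. -/
def PlaneLocalRing (i : Fin 3) (q : Fin 3 → ℂ) : Type :=
  Localization.AtPrime (pointIdeal i q)

instance (i : Fin 3) (q : Fin 3 → ℂ) : CommRing (PlaneLocalRing i q) :=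
  inferInstanceAs (CommRing (Localization.AtPrime (pointIdeal i q)))

instance (i : Fin 3) (q : Fin 3 → ℂ) :
    Algebra (MvPolynomial (Fin 2) ℂ) (PlaneLocalRing i q) :=
  inferInstanceAs (Algebra (MvPolynomial (Fin 2) ℂ) (Localization.AtPrime (pointIdeal i q)))

instance (i : Fin 3) (q : Fin 3 → ℂ) : Algebra ℂ (PlaneLocalRing i q) :=
  inferInstanceAs (Algebra ℂ (Localization.AtPrime (pointIdeal i q)))

instance (i : Fin 3) (q : Fin 3 → ℂ) :
    IsScalarTower ℂ (MvPolynomial (Fin 2) ℂ) (PlaneLocalRing i q) :=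
  inferInstanceAs (IsScalarTower ℂ (MvPolynomial (Fin 2) ℂ)
    (Localization.AtPrime (pointIdeal i q)))

instance (i : Fin 3) (q : Fin 3 → ℂ) :
    IsLocalization.AtPrime (PlaneLocalRing i q) (pointIdeal i q) :=
  inferInstanceAs (IsLocalization.AtPrime (Localization.AtPrime (pointIdeal i q))
    (pointIdeal i q))

instance (i : Fin 3) (q : Fin 3 → ℂ) : IsLocalRing (PlaneLocalRing i q) :=
  inferInstanceAs (IsLocalRing (Localization.AtPrime (pointIdeal i q)))

/-- The local equation at `q` of the plane curve defined by a form. -/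
def germ (i : Fin 3) (q : Fin 3 → ℂ) : MvPolynomial (Fin 3) ℂ →+* PlaneLocalRing i q :=
  (algebraMap (MvPolynomial (Fin 2) ℂ) (PlaneLocalRing i q)).comp (dehomogenize i).toRingHom

/-- The intersection multiplicity at `q` of the plane curves `U = 0` and `V = 0`. -/
def intersectionMultiplicity (i : Fin 3) (q : Fin 3 → ℂ) (U V : MvPolynomial (Fin 3) ℂ) : ℕ∞ :=
  Module.length (PlaneLocalRing i q) (PlaneLocalRing i q ⧸ Ideal.span {germ i q U, germ i q V})

/-- The local equation of the surface `G = 0` along the line through `o` that lies over `q`, as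
a polynomial in `w` over the local ring of the plane. -/
def localEquation (G : MvPolynomial (Fin 4) ℂ) (i : Fin 3) (q : Fin 3 → ℂ) :
    Polynomial (PlaneLocalRing i q) :=
  (asPolynomialInW G).map (germ i q)

/-! ### The rings `E_q ⊆ F_q` and the conductor -/

/-- `E_q`: the local ring at `q` of the apparent contour (with its scheme structure). -/
abbrev ApparentContourRing (G : MvPolynomial (Fin 4) ℂ) (i : Fin 3) (q : Fin 3 → ℂ) : Type :=
  PlaneLocalRing i q ⧸ Ideal.span {germ i q (apparentContour G)}

/-- The ring `O[w] / (f, ∂f/∂w)` of a polynomial `f` in `w` over a ring `O`. -/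
abbrev CriticalRing {O : Type*} [CommRing O] (f : Polynomial O) : Type _ :=
  Polynomial O ⧸ Ideal.span {f, Polynomial.derivative f}

/-- `F_q`: the ring of germs along the fibre over `q` of regular functions on the contour (with its
scheme structure). If `o` does not lie on the surface, then the contour is finite over the plane and
lies in the complement of `o`; hence its coordinate ring over the local ring `O` of the plane at `q`
is `O[w] / (f, ∂f/∂w)`, and all its maximal ideals belong to the points of the fibre over `q`. -/
abbrev ContourRing (G : MvPolynomial (Fin 4) ℂ) (i : Fin 3) (q : Fin 3 → ℂ) : Type :=
  CriticalRing (localEquation G i q)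

/-- The ring homomorphism `O / (d) → O[w] / (f, ∂f/∂w)`, for an element `d` of the ideal
`(f, ∂f/∂w)`. -/
def criticalMap {O : Type*} [CommRing O] (d : O) (f : Polynomial O)
    (h : Polynomial.C d ∈ Ideal.span {f, Polynomial.derivative f}) :
    O ⧸ Ideal.span {d} →+* CriticalRing f :=
  Ideal.Quotient.lift _ ((Ideal.Quotient.mk _).comp Polynomial.C) (by
    intro a ha
    obtain ⟨b, rfl⟩ := Ideal.mem_span_singleton'.mp ha
    rw [RingHom.comp_apply, Ideal.Quotient.eq_zero_iff_mem, Polynomial.C_mul]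
    exact Ideal.mul_mem_left _ _ h)

/-- The discriminant of a polynomial with invertible leading coefficient is a combination of the
polynomial and its derivative. -/
theorem discr_mem_span {R : Type*} [CommRing R] (f : Polynomial R) (hf : IsUnit f.leadingCoeff) :
    Polynomial.C f.discr ∈ Ideal.span {f, Polynomial.derivative f} := by
  by_cases hd : 0 < f.degree
  · have h0 : f.natDegree ≠ 0 := by
      have := Polynomial.natDegree_pos_iff_degree_pos.mpr hd
      omega
    obtain ⟨a, b, -, -, hab⟩ := Polynomial.exists_mul_add_mul_eq_C_resultant f
      (Polynomial.derivative f) (m := f.natDegree) (n := f.natDegree - 1) le_rfl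
      (Polynomial.natDegree_derivative_le f) (Or.inl h0)
    rw [Polynomial.resultant_deriv hd] at hab
    have hm : Polynomial.C ((-1) ^ (f.natDegree * (f.natDegree - 1) / 2) * f.leadingCoeff
        * f.discr) ∈ Ideal.span {f, Polynomial.derivative f} := by
      rw [← hab]
      exact Ideal.add_mem _ (Ideal.mul_mem_right _ _ (Ideal.subset_span (by simp)))
        (Ideal.mul_mem_right _ _ (Ideal.subset_span (by simp)))
    rw [Polynomial.C_mul] at hm
    have hu : IsUnit (Polynomial.C ((-1) ^ (f.natDegree * (f.natDegree - 1) / 2)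
        * f.leadingCoeff)) :=
      ((((isUnit_one.neg).pow _).mul hf).map Polynomial.C)
    exact (Ideal.unit_mul_mem_iff_mem _ hu).mp hm
  · have h := Polynomial.eq_C_of_degree_le_zero (not_lt.mp hd)
    have hu : IsUnit f := by
      rw [h] at hf ⊢
      rw [Polynomial.leadingCoeff_C] at hf
      exact hf.map Polynomial.C
    have ht : Ideal.span {f, Polynomial.derivative f} = ⊤ :=
      Ideal.eq_top_of_isUnit_mem _ (Ideal.subset_span (by simp)) hu
    rw [ht]
    trivial

/-- The leading coefficient in `w` of a quartic form that does not vanish at `o` is a unit. -/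
theorem isUnit_leadingCoeff (G : MvPolynomial (Fin 4) ℂ) (hG : G.IsHomogeneous 4)
    (ho : MvPolynomial.eval center G ≠ 0) : IsUnit (asPolynomialInW G).leadingCoeff := by
  have hG0 : G ≠ 0 := by
    rintro rfl
    simp at ho
  have hdeg : (asPolynomialInW G).natDegree ≤ 4 := by
    rw [asPolynomialInW, MvPolynomial.natDegree_finSuccEquiv]
    exact (MvPolynomial.degreeOf_le_totalDegree G 0).trans hG.totalDegree_le
  have hcenter : center = Fin.cons 1 0 := by
    funext k
    refine Fin.cases ?_ (fun j => ?_) k <;> simp [center]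
  have hcoeff : ∀ j < 4, MvPolynomial.eval 0 ((asPolynomialInW G).coeff j) = 0 := by
    intro j hj
    have h := hG.finSuccEquiv_coeff_isHomogeneous j (4 - j) (by omega)
    have h0 := h.coeff_eq_zero (d := 0) (by simp; omega)
    rw [← MvPolynomial.constantCoeff_eq] at h0
    simpa [asPolynomialInW, MvPolynomial.eval_zero] using h0
  have h4 : MvPolynomial.eval 0 ((asPolynomialInW G).coeff 4) ≠ 0 := by
    intro h
    apply ho
    rw [hcenter, MvPolynomial.eval_eq_eval_mv_eval', Polynomial.eval_map]
    change Polynomial.eval₂ _ _ (asPolynomialInW G) = 0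
    rw [Polynomial.eval₂_eq_sum_range' _ (Nat.lt_succ_of_le hdeg)]
    refine Finset.sum_eq_zero fun j hj => ?_
    rw [Finset.mem_range] at hj
    rcases Nat.lt_or_ge j 4 with h' | h'
    · rw [hcoeff j h', zero_mul]
    · obtain rfl : j = 4 := by omega
      rw [h, zero_mul]
  have hne : (asPolynomialInW G).coeff 4 ≠ 0 := fun h => h4 (by rw [h, map_zero])
  have hnat : (asPolynomialInW G).natDegree = 4 :=
    le_antisymm hdeg (Polynomial.le_natDegree_of_ne_zero hne)
  have hhom := hG.finSuccEquiv_coeff_isHomogeneous 4 0 (by norm_num)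
  have htot := MvPolynomial.totalDegree_eq_zero_iff_eq_C.mp
    (Nat.le_zero.mp hhom.totalDegree_le)
  rw [Polynomial.leadingCoeff, hnat]
  unfold asPolynomialInW at hne ⊢
  rw [htot] at hne ⊢
  refine IsUnit.map MvPolynomial.C (isUnit_iff_ne_zero.mpr fun h => hne ?_)
  rw [h, map_zero]

theorem germ_apparentContour_mem (G : MvPolynomial (Fin 4) ℂ) (hG : G.IsHomogeneous 4)
    (ho : MvPolynomial.eval center G ≠ 0) (i : Fin 3) (q : Fin 3 → ℂ) :
    Polynomial.C (germ i q (apparentContour G)) ∈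
      Ideal.span {localEquation G i q, Polynomial.derivative (localEquation G i q)} := by
  have h := Ideal.mem_map_of_mem (Polynomial.mapRingHom (germ i q))
    (discr_mem_span (asPolynomialInW G) (isUnit_leadingCoeff G hG ho))
  rw [Ideal.map_span, Set.image_pair] at h
  simpa [localEquation, apparentContour, Polynomial.derivative_map] using h

/-- The ring homomorphism `E_q → F_q` induced by the projection of the quartic surface `G = 0` from
a point `o` off the surface. -/
def localProjection (G : MvPolynomial (Fin 4) ℂ) (hG : G.IsHomogeneous 4)
    (ho : MvPolynomial.eval center G ≠ 0) (i : Fin 3) (q : Fin 3 → ℂ) :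
    ApparentContourRing G i q →+* ContourRing G i q :=
  criticalMap _ _ (germ_apparentContour_mem G hG ho i q)

/-- The conductor of `A` in `B`, for a ring homomorphism `φ : A → B`: the ideal of all `a` in `A`
with `a B ⊆ φ(A)`. -/
def conductorIdeal {A B : Type*} [CommRing A] [CommRing B] (φ : A →+* B) : Ideal A where
  carrier := {a | ∀ b : B, ∃ c : A, φ a * b = φ c}
  add_mem' := by
    intro a₁ a₂ h₁ h₂ b
    obtain ⟨c₁, hc₁⟩ := h₁ b
    obtain ⟨c₂, hc₂⟩ := h₂ b
    exact ⟨c₁ + c₂, by rw [map_add, map_add, add_mul, hc₁, hc₂]⟩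
  zero_mem' := fun b => ⟨0, by simp⟩
  smul_mem' := by
    intro r a h b
    obtain ⟨c, hc⟩ := h b
    exact ⟨r * c, by rw [smul_eq_mul, map_mul, map_mul, mul_assoc, hc]⟩

/-! ### The mixed jacobian ideal -/

/-- `x, y` is a regular system of parameters of the (two-dimensional regular) local ring `O`, and
`D₁ = ∂/∂x`, `D₂ = ∂/∂y` are the partial derivatives with respect to it. -/
def IsPartialDerivatives {k O : Type*} [CommRing k] [CommRing O] [IsLocalRing O] [Algebra k O]
    (x y : O) (D₁ D₂ : Derivation k O O) : Prop :=
  IsLocalRing.maximalIdeal O = Ideal.span {x, y} ∧ D₁ x = 1 ∧ D₁ y = 0 ∧ D₂ x = 0 ∧ D₂ y = 1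

/-- The mixed jacobian ideal `∂(I, J, lam, K)` of a two-dimensional regular local ring: it is
generated by all elements `∂(F, H)/∂(x, y) * G + lam * F * ∂(G, H)/∂(x, y)` with `F ∈ I`, `G ∈ J`,
`H ∈ K` and any regular system of parameters `x, y`. -/
def mixedJacobianIdeal {k O : Type*} [CommRing k] [CommRing O] [IsLocalRing O] [Algebra k O]
    (I J : Ideal O) (lam : k) (K : Ideal O) : Ideal O :=
  Ideal.span {a | ∃ (x y : O) (D₁ D₂ : Derivation k O O), IsPartialDerivatives x y D₁ D₂ ∧
    ∃ F ∈ I, ∃ G ∈ J, ∃ H ∈ K,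
      a = (D₁ F * D₂ H - D₂ F * D₁ H) * G
        + algebraMap k O lam * F * (D₁ G * D₂ H - D₂ G * D₁ H)}

/-- The equation of a Darboux cyclide is a quartic form, from every camera position. -/
theorem IsDarbouxCyclide.isHomogeneous_viewFrom {F : MvPolynomial (Fin 4) ℝ}
    (hF : IsDarbouxCyclide F) (c : Fin 3 → ℝ) : (viewFrom c F).IsHomogeneous 4 := by
  obtain ⟨⟨L, Q, hL, hQ, rfl⟩, -⟩ := hF
  have hA : (absoluteForm ℝ).IsHomogeneous 2 :=
    MvPolynomial.IsHomogeneous.sum _ _ _ fun j _ => by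
      simpa using (MvPolynomial.isHomogeneous_X ℝ j).pow 2
  have hA' := hA.rename_isHomogeneous (f := Fin.succ)
  have hL' := hL.rename_isHomogeneous (f := Fin.succ)
  have hw := MvPolynomial.isHomogeneous_X ℝ (0 : Fin 4)
  have h2 : (2 : MvPolynomial (Fin 4) ℝ).IsHomogeneous 0 :=
    MvPolynomial.isHomogeneous_C (Fin 4) (2 : ℝ)
  have hH : (MvPolynomial.rename Fin.succ (absoluteForm ℝ) ^ 2
      + 2 * MvPolynomial.rename Fin.succ (absoluteForm ℝ) * MvPolynomial.rename Fin.succ L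
        * MvPolynomial.X 0
      + Q * MvPolynomial.X 0 ^ 2 : MvPolynomial (Fin 4) ℝ).IsHomogeneous 4 :=
    ((hA'.pow 2).add (((h2.mul hA').mul hL').mul hw)).add (hQ.mul (hw.pow 2))
  refine MvPolynomial.IsHomogeneous.map ?_ _
  have := hH.aeval (S := ℝ) (n := 1) (Fin.cons (MvPolynomial.X 0)
      (fun j : Fin 3 => MvPolynomial.X j.succ + MvPolynomial.C (c j) * MvPolynomial.X 0) :
        Fin 4 → MvPolynomial (Fin 4) ℝ) (by
    intro k
    refine Fin.cases ?_ (fun j => ?_) k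
    · simpa using hw
    · simpa using (MvPolynomial.isHomogeneous_X ℝ j.succ).add
        ((MvPolynomial.isHomogeneous_C (Fin 4) (c j)).mul hw))
  simpa using this

end

/-! The cusp condition says that the quadratic part of a general plane section at a point of the
absolute conic is a square, that is, `Q = L²` on the conic. Hence `Q - L²` restricted to `w = 0` is
a multiple of `A`, and completing the square gives `F = (A + L w + k w²)² + (M + e w) w³`, a form
that is stable under translation. Irreducibility gives `M ≠ 0`.

The discriminant of this quartic in `w` is `U₁ A³` with `U₁ ≡ 4 L³ M (M² + 4 k L M - 4 e L²)` modulo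
`A`. Eliminating `A` from `F = ∂F/∂w = 0` shows that `M L² = 0` on the points of `C_A` in the
residual contour. For a generic camera the lines `L = 0` and `M = 0` do not meet on the conic and
are not tangent to it. So `U₁` meets the conic with multiplicity 1 where `M = 0` and 3 where `L =
0`; tangency selects the points with `L = 0`.

At such a point `M` is a unit and can be scaled to 1, and `l = L`, `a = A` become local parameters.
A Euclidean step yields a quadratic polynomial with unit leading coefficient in `(f, f')`, so `F_q`
is generated by `1, w` over `O`. The next step yields a linear relation `S w + T = 0`, and the
conductor is `(S, T)` (`comap_conductorIdeal_criticalMap_quartic`).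

It remains to identify `(S, T)` with the mixed jacobian ideal (`mixedJacobianIdeal_cuspDiscr`). Give
`a, l, w` the weights 3, 1, 2. The leading forms of `U₁`, `S`, `T` are `4l³ - 27a`, `48al - 8l⁴`,
`36a² - 8al³`. The jacobian generators for `H = l²` and `H = al` have the leading forms of `-9S` and
`-6T`. All monomials of weight at least 7 lie in `𝔪 (S, T)` (`cusp_monomials_le`), and Nakayama's
lemma absorbs the remainders. -/

/-! ### Discriminant of a quartic polynomial. -/

open Polynomial in
/-- The quartic polynomial with the given coefficients. -/
noncomputable def quartic {R : Type*} [CommRing R] (f₀ f₁ f₂ f₃ f₄ : R) : Polynomial R :=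
  C f₀ + C f₁ * X + C f₂ * X ^ 2 + C f₃ * X ^ 3 + C f₄ * X ^ 4

theorem sylvesterDeriv_of_natDegree_eq_four {R : Type*} [CommRing R] {f : Polynomial R}
    (hf : f.natDegree = 4) :
    f.sylvesterDeriv.reindex (finCongr <| by rw [hf]) (finCongr <| by rw [hf]) =
    !![ f.coeff 0, 0, 0, f.coeff 1, 0, 0, 0;
        f.coeff 1, f.coeff 0, 0, 2 * f.coeff 2, f.coeff 1, 0, 0;
        f.coeff 2, f.coeff 1, f.coeff 0, 3 * f.coeff 3, 2 * f.coeff 2, f.coeff 1, 0;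
        f.coeff 3, f.coeff 2, f.coeff 1, 4 * f.coeff 4, 3 * f.coeff 3, 2 * f.coeff 2, f.coeff 1;
        f.coeff 4, f.coeff 3, f.coeff 2, 0, 4 * f.coeff 4, 3 * f.coeff 3, 2 * f.coeff 2;
        0, f.coeff 4, f.coeff 3, 0, 0, 4 * f.coeff 4, 3 * f.coeff 3;
        -- The last row of `sylvesterDeriv` has the leading coefficient divided out, so `1` and `4`
        -- replace `f₄` and `4 f₄`.
        0, 0, 1, 0, 0, 0, (4 : R)] := by
  ext ⟨i, hi⟩ ⟨j, hj⟩
  simp only [Polynomial.sylvesterDeriv, hf, OfNat.ofNat_ne_zero, ↓reduceDIte, Polynomial.sylvester,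
    Fin.addCases, Nat.add_one_sub_one, Fin.val_castLT, Set.mem_Icc, Fin.val_fin_le, Fin.val_subNat,
    Fin.val_cast, tsub_le_iff_right, Polynomial.coeff_derivative, eq_rec_constant, dite_eq_ite,
    Nat.reduceMul, Nat.reduceSub, Nat.cast_ofNat, Matrix.reindex_apply, finCongr_symm,
    Matrix.submatrix_apply, finCongr_apply, Fin.cast_mk, Matrix.updateRow_apply, Fin.mk.injEq,
    Matrix.of_apply, Fin.mk_le_mk, Matrix.cons_val', Matrix.cons_val_fin_one]
  have hi' : i ∈ Finset.range 7 := Finset.mem_range.mpr hi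
  have hj' : j ∈ Finset.range 7 := Finset.mem_range.mpr hj
  fin_cases hi' <;>
  · simp only [and_true, Fin.isValue, Fin.mk_one, Fin.reduceFinMk, Fin.zero_eta,
      le_add_iff_nonneg_left, Matrix.cons_val_one, Matrix.cons_val_zero, Matrix.cons_val,
      Nat.reduceAdd, Nat.reduceEqDiff, Nat.reduceLeDiff, nonpos_iff_eq_zero,
      OfNat.one_ne_ofNat, ↓reduceIte, zero_add, zero_le]
    fin_cases hj' <;> simp [mul_comm, one_add_one_eq_two, (by norm_num : (2 : R) + 1 = 3),
      (by norm_num : (3 : R) + 1 = 4)]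

set_option maxHeartbeats 2000000 in
theorem discr_of_natDegree_eq_four {R : Type*} [CommRing R] {f : Polynomial R}
    (hf : f.natDegree = 4) {a b c d e : R} (ha : f.coeff 4 = a) (hb : f.coeff 3 = b)
    (hc : f.coeff 2 = c) (hd : f.coeff 1 = d) (he : f.coeff 0 = e) :
    f.discr = 256 * a ^ 3 * e ^ 3 - 192 * a ^ 2 * b * d * e ^ 2 - 128 * a ^ 2 * c ^ 2 * e ^ 2
      + 144 * a ^ 2 * c * d ^ 2 * e - 27 * a ^ 2 * d ^ 4 + 144 * a * b ^ 2 * c * e ^ 2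
      - 6 * a * b ^ 2 * d ^ 2 * e - 80 * a * b * c ^ 2 * d * e + 18 * a * b * c * d ^ 3
      + 16 * a * c ^ 4 * e - 4 * a * c ^ 3 * d ^ 2 - 27 * b ^ 4 * e ^ 2 + 18 * b ^ 3 * c * d * e
      - 4 * b ^ 3 * d ^ 3 - 4 * b ^ 2 * c ^ 3 * e + b ^ 2 * c ^ 2 * d ^ 2 := by
  let ε : Fin ((f.natDegree - 1) + f.natDegree) ≃ Fin 7 := finCongr (by rw [hf])
  rw [Polynomial.discr, ← Matrix.det_reindex_self ε, sylvesterDeriv_of_natDegree_eq_four hf,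
    ha, hb, hc, hd, he]
  simp [Matrix.det_succ_row_zero (n := 6), Matrix.det_succ_row_zero (n := 5),
    Matrix.det_succ_row_zero (n := 4), Matrix.det_succ_row_zero (n := 3), Fin.succAbove,
    Matrix.det_fin_three, Finset.sum_fin_eq_sum_range, Finset.sum_range_succ, hf]
  ring

/-! ### Subresultants and discriminant of the local model. -/

/-- The coefficient of `w` in the remainder of the pseudodivision of `4 f - w f'` by the quadratic
subresultant, for the quartic `f = f₀ + f₁ w + f₂ w² + f₃ w³ + f₄ w⁴`. -/
def quarticSubresLin {R : Type*} [CommRing R] (f₀ f₁ f₂ f₃ f₄ : R) : R :=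
  (8 * f₄ * f₂ - 3 * f₃ ^ 2) * (3 * f₁ * (8 * f₄ * f₂ - 3 * f₃ ^ 2) - f₃ * (16 * f₄ * f₀ - f₃ * f₁))
    - (12 * f₄ * f₁ - 2 * f₂ * f₃)
      * (2 * f₂ * (8 * f₄ * f₂ - 3 * f₃ ^ 2) - f₃ * (12 * f₄ * f₁ - 2 * f₂ * f₃))

/-- The constant coefficient in the remainder of the pseudodivision of `4 f - w f'` by the quadratic
subresultant, for the quartic `f = f₀ + f₁ w + f₂ w² + f₃ w³ + f₄ w⁴`. -/
def quarticSubresConst {R : Type*} [CommRing R] (f₀ f₁ f₂ f₃ f₄ : R) : R :=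
  4 * f₀ * (8 * f₄ * f₂ - 3 * f₃ ^ 2) ^ 2
    - (16 * f₄ * f₀ - f₃ * f₁)
      * (2 * f₂ * (8 * f₄ * f₂ - 3 * f₃ ^ 2) - f₃ * (12 * f₄ * f₁ - 2 * f₂ * f₃))

/-- `quarticSubresLin` for the quartic `(a + l w + k w²)² + w³ + e w⁴`. -/
def cuspLin {R : Type*} [CommRing R] (a l k e : R) : R :=
  quarticSubresLin (a ^ 2) (2 * a * l) (l ^ 2 + 2 * k * a) (2 * k * l + 1) (k ^ 2 + e)

/-- `quarticSubresConst` for the quartic `(a + l w + k w²)² + w³ + e w⁴`. -/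
def cuspConst {R : Type*} [CommRing R] (a l k e : R) : R :=
  quarticSubresConst (a ^ 2) (2 * a * l) (l ^ 2 + 2 * k * a) (2 * k * l + 1) (k ^ 2 + e)

/-- The quotient by `a³` of the discriminant of `(a + l w + k w²)² + m w³ + e w⁴`. -/
def cuspDiscr {R : Type*} [CommRing R] (a l m k e : R) : R :=
  4 * l ^ 3 * m ^ 3 + 16 * l ^ 4 * m ^ 2 * k - 16 * l ^ 5 * m * e - 27 * a * m ^ 4 - 144 * a * l *
  m ^ 3 * k + 120 * a * l ^ 2 * m ^ 2 * e - 128 * a * l ^ 2 * m ^ 2 * k ^ 2 + 128 * a * l ^ 3 * m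
  * k * e + 16 * a * l ^ 4 * e ^ 2 + 288 * a ^ 2 * m ^ 2 * k * e + 256 * a ^ 2 * m ^ 2 * k ^ 3 -
  384 * a ^ 2 * l * m * e ^ 2 - 256 * a ^ 2 * l * m * k ^ 2 * e - 128 * a ^ 2 * l ^ 2 * k * e ^ 2
  + 256 * a ^ 3 * e ^ 3 + 256 * a ^ 3 * k ^ 2 * e ^ 2

/-- The derivative of `cuspDiscr a l 1 k e` in the direction of `a`. -/
def cuspDiscrDa {R : Type*} [CommRing R] (a l k e : R) : R :=
  -27 - 144 * l * k + 120 * l ^ 2 * e - 128 * l ^ 2 * k ^ 2 + 128 * l ^ 3 * k * e + 16 * l ^ 4 * e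
  ^ 2 + 576 * a * k * e + 512 * a * k ^ 3 - 768 * a * l * e ^ 2 - 512 * a * l * k ^ 2 * e - 256 *
  a * l ^ 2 * k * e ^ 2 + 768 * a ^ 2 * e ^ 3 + 768 * a ^ 2 * k ^ 2 * e ^ 2

/-- The derivative of `cuspDiscr a l 1 k e` in the direction of `l`. -/
def cuspDiscrDl {R : Type*} [CommRing R] (a l k e : R) : R :=
  12 * l ^ 2 + 64 * l ^ 3 * k - 80 * l ^ 4 * e - 144 * a * k + 240 * a * l * e - 256 * a * l * k ^
  2 + 384 * a * l ^ 2 * k * e + 64 * a * l ^ 3 * e ^ 2 - 384 * a ^ 2 * e ^ 2 - 256 * a ^ 2 * k ^ 2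
  * e - 256 * a ^ 2 * l * k * e ^ 2

/-! ### Polynomial identities graded by weight. -/

/-- For the weights 3, 1, -1, -2 of `a, l, k, e` both subresultants are homogeneous, so terms with
`k` or `e` carry monomials in `a, l` of higher weight. Here and in the next three identities, the
leading forms `48al - 8l⁴` and `36a² - 8al³` are combined to a single monomial. The right side has
the shape `a y + l z`, with `y, z` in the ideal of the subresultants and the four monomials, which
is what Nakayama's lemma needs. -/
theorem mul_sq_mul_eq_subres {R : Type*} [CommRing R] (a l k e : R) :
    (-108) * (a ^ 2 * l) =
      a * ((-9) * cuspLin a l k e + (12 * e + 4 * k ^ 2) * cuspConst a l k e + (768 * k * e ^ 2 +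
      1792 * k ^ 3 * e + 1024 * k ^ 5) * (a ^ 3)) + l * (9 * cuspConst a l k e + (720 * k - 336 *
      l * e + 1328 * l * k ^ 2 - 576 * l ^ 2 * k * e + 768 * l ^ 2 * k ^ 3 - 384 * l ^ 3 * e ^ 2 +
      64 * l ^ 3 * k ^ 2 * e + 256 * l ^ 3 * k ^ 4 - 768 * l ^ 4 * k * e ^ 2 - 256 * l ^ 4 * k ^ 3
      * e + 2688 * a * e ^ 2 - 4672 * a * k ^ 2 * e - 4672 * a * k ^ 4 + 8064 * a * l * k * e ^ 2
      + 1152 * a * l * k ^ 3 * e - 1536 * a * l * k ^ 5 + 5376 * a * l ^ 2 * k ^ 2 * e ^ 2 + 1792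
      * a * l ^ 2 * k ^ 4 * e - 9216 * a ^ 2 * k * e ^ 3 - 12288 * a ^ 2 * k ^ 3 * e ^ 2 - 3072 *
      a ^ 2 * k ^ 5 * e) * (a ^ 2 * l) + (-2400 * k * e - 1952 * k ^ 3 - 4608 * a * e ^ 3 - 4608 *
      a * k ^ 2 * e ^ 2 + 2048 * a * k ^ 4 * e + 2048 * a * k ^ 6) * (a ^ 3)) := by
  simp only [cuspLin, cuspConst, quarticSubresLin, quarticSubresConst]
  ring

theorem mul_mul_pow_four_eq_subres {R : Type*} [CommRing R] (a l k e : R) :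
    (-24) * (a * l ^ 4) =
      a * ((-9) * cuspLin a l k e + (12 * e + 4 * k ^ 2) * cuspConst a l k e + (768 * k * e ^ 2 +
      1792 * k ^ 3 * e + 1024 * k ^ 5) * (a ^ 3)) + l * (12 * cuspConst a l k e + (-96 * k + 192 *
      l * e - 448 * l * k ^ 2 + 1152 * l ^ 2 * k * e - 384 * l ^ 2 * k ^ 3 - 384 * l ^ 3 * e ^ 2 +
      1408 * l ^ 3 * k ^ 2 * e + 256 * l ^ 3 * k ^ 4 - 768 * l ^ 4 * k * e ^ 2 - 256 * l ^ 4 * k ^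
      3 * e + 1536 * a * e ^ 2 - 4288 * a * k ^ 2 * e - 3136 * a * k ^ 4 + 5760 * a * l * k * e ^
      2 - 1152 * a * l * k ^ 3 * e - 1536 * a * l * k ^ 5 + 5376 * a * l ^ 2 * k ^ 2 * e ^ 2 +
      1792 * a * l ^ 2 * k ^ 4 * e - 9216 * a ^ 2 * k * e ^ 3 - 12288 * a ^ 2 * k ^ 3 * e ^ 2 -
      3072 * a ^ 2 * k ^ 5 * e) * (a ^ 2 * l) + (144 * k - 96 * l * e + 192 * l * k ^ 2 - 192 * l
      ^ 2 * k * e) * (a * l ^ 4) + (-1632 * k * e - 1184 * k ^ 3 - 4608 * a * e ^ 3 - 4608 * a * k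
      ^ 2 * e ^ 2 + 2048 * a * k ^ 4 * e + 2048 * a * k ^ 6) * (a ^ 3)) := by
  simp only [cuspLin, cuspConst, quarticSubresLin, quarticSubresConst]
  ring

theorem mul_pow_seven_eq_subres {R : Type*} [CommRing R] (a l k e : R) :
    (-8) * (l ^ 7) =
      a * ((-18) * cuspLin a l k e + (24 * e + 8 * k ^ 2) * cuspConst a l k e + (1536 * k * e ^ 2
      + 3584 * k ^ 3 * e + 2048 * k ^ 5) * (a ^ 3)) + l * (l ^ 2 * cuspLin a l k e + 24 *
      cuspConst a l k e + (-192 * k + 336 * l * e - 912 * l * k ^ 2 + 2464 * l ^ 2 * k * e - 416 *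
      l ^ 2 * k ^ 3 - 1216 * l ^ 3 * e ^ 2 + 2752 * l ^ 3 * k ^ 2 * e + 1280 * l ^ 3 * k ^ 4 -
      2432 * l ^ 4 * k * e ^ 2 - 1664 * l ^ 4 * k ^ 3 * e + 3072 * a * e ^ 2 - 8576 * a * k ^ 2 *
      e - 6272 * a * k ^ 4 + 11776 * a * l * k * e ^ 2 - 2048 * a * l * k ^ 3 * e - 3072 * a * l *
      k ^ 5 + 11264 * a * l ^ 2 * k ^ 2 * e ^ 2 + 4096 * a * l ^ 2 * k ^ 4 * e - 18432 * a ^ 2 * k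
      * e ^ 3 - 24576 * a ^ 2 * k ^ 3 * e ^ 2 - 6144 * a ^ 2 * k ^ 5 * e) * (a ^ 2 * l) + (-64 * k
      + 32 * l * e - 352 * l * k ^ 2 + 320 * l ^ 2 * k * e - 448 * l ^ 2 * k ^ 3 + 512 * l ^ 3 * k
      ^ 2 * e) * (a * l ^ 4) + (48 * k - 32 * l * e + 64 * l * k ^ 2 - 64 * l ^ 2 * k * e) * (l ^
      7) + (-3264 * k * e - 2368 * k ^ 3 - 9216 * a * e ^ 3 - 9216 * a * k ^ 2 * e ^ 2 + 4096 * a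
      * k ^ 4 * e + 4096 * a * k ^ 6) * (a ^ 3)) := by
  simp only [cuspLin, cuspConst, quarticSubresLin, quarticSubresConst]
  ring

theorem mul_cube_eq_subres {R : Type*} [CommRing R] (a l k e : R) :
    36 * (a ^ 3) =
      a * (cuspConst a l k e + (256 * k * e + 256 * k ^ 3) * (a ^ 3)) + l * ((8 * l + 48 * l ^ 2 *
      k - 32 * l ^ 3 * e + 64 * l ^ 3 * k ^ 2 - 64 * l ^ 4 * k * e + 176 * a * e - 592 * a * k ^ 2
      + 576 * a * l * k * e - 384 * a * l * k ^ 3 + 448 * a * l ^ 2 * k ^ 2 * e - 768 * a ^ 2 * k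
      * e ^ 2 - 768 * a ^ 2 * k ^ 3 * e) * (a ^ 2 * l) + (-272 * k - 384 * a * e ^ 2 + 128 * a * k
      ^ 2 * e + 512 * a * k ^ 4) * (a ^ 3)) := by
  simp only [cuspConst, quarticSubresConst]
  ring

/-- The left side is the mixed jacobian generator for `H = l²`. On leading forms, `λ = -9` is the
only coefficient for which `a ∂U/∂a + λ U`, with `U = 4l³ - 27a`, is proportional to `6a - l³`,
hence `l` times it to the leading form of `cuspLin`. -/
theorem mixedJacobian_sq_eq {R : Type*} [CommRing R] (a l k e : R) :
    2 * l * (9 * cuspDiscr a l 1 k e - a * cuspDiscrDa a l k e) =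
      (-9) * cuspLin a l k e + (18 * k - 36 * l * k ^ 2) * (l * cuspLin a l k e) + (12 * e + 4 * k ^ 2) * cuspConst
      a l k e + (-1536 * k * e - 960 * k ^ 3 + 768 * l * e ^ 2 - 4800 * l * k ^ 2 * e - 2368 * l *
      k ^ 4 + 5120 * l ^ 2 * k * e ^ 2 + 1152 * l ^ 2 * k ^ 3 * e - 384 * l ^ 2 * k ^ 5 + 5376 * l
      ^ 3 * k ^ 2 * e ^ 2 - 16640 * l ^ 3 * k ^ 4 * e - 27648 * l ^ 3 * k ^ 6 + 32256 * l ^ 4 * k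
      ^ 3 * e ^ 2 + 41472 * l ^ 4 * k ^ 5 * e - 1536 * a * e ^ 3 + 3072 * a * k ^ 2 * e ^ 2 + 6656
      * a * k ^ 4 * e + 2048 * a * k ^ 6 - 9216 * a * l * k * e ^ 3 - 12288 * a * l * k ^ 3 * e ^
      2 - 3072 * a * l * k ^ 5 * e - 18432 * a * l ^ 2 * k ^ 4 * e ^ 2 - 18432 * a * l ^ 2 * k ^ 6
      * e) * (a ^ 2 * l) + (320 * k * e + 3648 * k ^ 3 - 128 * l * e ^ 2 + 640 * l * k ^ 2 * e +
      18688 * l * k ^ 4 - 768 * l ^ 2 * k * e ^ 2 - 16384 * l ^ 2 * k ^ 3 * e + 16128 * l ^ 2 * k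
      ^ 5 - 18432 * l ^ 3 * k ^ 4 * e) * (a * l ^ 4) + (-576 * k ^ 3 - 2304 * l * k ^ 4 + 2304 * l
      ^ 2 * k ^ 3 * e) * (l ^ 7) + (768 * k * e ^ 2 + 1792 * k ^ 3 * e + 1024 * k ^ 5) * (a ^ 3) := by
  simp only [cuspLin, cuspConst, quarticSubresLin, quarticSubresConst, cuspDiscr,
    cuspDiscrDa]
  ring

/-- The left side is the mixed jacobian generator for `H = a l`. Its leading form is `48al³ -
216a²`, and the remainder consists of terms of weight at least 7. -/
theorem mixedJacobian_mul_eq {R : Type*} [CommRing R] (a l k e : R) :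
    a * (9 * cuspDiscr a l 1 k e - a * cuspDiscrDa a l k e) + a * l * cuspDiscrDl a l k e =
      (-6) * cuspConst a l k e + (336 * k + 144 * l * e + 2272 * l * k ^ 2 - 2048 * l ^ 2 * k * e
      + 2304 * l ^ 2 * k ^ 3 + 192 * l ^ 3 * e ^ 2 - 2688 * l ^ 3 * k ^ 2 * e - 768 * a * e ^ 2 -
      2816 * a * k ^ 2 * e - 3072 * a * k ^ 4 + 3456 * a * l * k * e ^ 2 + 4608 * a * l * k ^ 3 *
      e) * (a ^ 2 * l) + (-80 * k - 32 * l * e - 384 * l * k ^ 2 + 384 * l ^ 2 * k * e) * (a * l ^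
      4) + (480 * k * e + 256 * k ^ 3 + 1536 * a * e ^ 3 + 1536 * a * k ^ 2 * e ^ 2) * (a ^ 3) := by
  simp only [cuspConst, quarticSubresConst, cuspDiscr, cuspDiscrDa,
    cuspDiscrDl]
  ring

theorem derivation_cuspDiscr {k R : Type*} [CommRing k] [CommRing R] [Algebra k R]
    (D : Derivation k R R) (a l : R) (κ ε : k) :
    D (cuspDiscr a l 1 (algebraMap k R κ) (algebraMap k R ε)) =
      cuspDiscrDl a l (algebraMap k R κ) (algebraMap k R ε) * D l
        + cuspDiscrDa a l (algebraMap k R κ) (algebraMap k R ε) * D a := by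
  have h (n : ℕ) [n.AtLeastTwo] : D (OfNat.ofNat n : R) = 0 := D.map_natCast n
  simp only [cuspDiscr, cuspDiscrDl, cuspDiscrDa, map_add, map_sub, Derivation.leibniz,
    Derivation.leibniz_pow, Derivation.map_algebraMap, h, smul_eq_mul,
    nsmul_eq_mul, one_pow, mul_one, mul_zero, smul_zero]
  norm_num
  ring

/-- Every term has weight at least 3, so products with `a l` or `a²` have weight at least 7. -/
theorem exists_cuspDiscr_eq {R : Type*} [CommRing R] (a l k e : R) :
    ∃ p q : R, cuspDiscr a l 1 k e = l ^ 3 * p + a * q :=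
  ⟨4 + 16 * l * k - 16 * l ^ 2 * e,
    -27 - 144 * l * k + 120 * l ^ 2 * e - 128 * l ^ 2 * k ^ 2 + 128 * l ^ 3 * k * e + 16 * l ^ 4 *
    e ^ 2 + 288 * a * k * e + 256 * a * k ^ 3 - 384 * a * l * e ^ 2 - 256 * a * l * k ^ 2 * e -
    128 * a * l ^ 2 * k * e ^ 2 + 256 * a ^ 2 * e ^ 3 + 256 * a ^ 2 * k ^ 2 * e ^ 2,
    by simp only [cuspDiscr]; ring⟩

theorem exists_cuspDiscrDl_eq {R : Type*} [CommRing R] (a l k e : R) :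
    ∃ p q : R, cuspDiscrDl a l k e = l ^ 2 * p + a * q :=
  ⟨12 + 64 * l * k - 80 * l ^ 2 * e,
    -144 * k + 240 * l * e - 256 * l * k ^ 2 + 384 * l ^ 2 * k * e + 64 * l ^ 3 * e ^ 2 - 384 * a
    * e ^ 2 - 256 * a * k ^ 2 * e - 256 * a * l * k * e ^ 2,
    by simp only [cuspDiscrDl]; ring⟩

theorem Ideal.mem_of_intCast_mul_mem (K : Type*) {O : Type*} [Field K] [CharZero K] [CommRing O]
    [Algebra K O] {J : Ideal O} (c : ℤ) (hc : c ≠ 0) {x : O} (h : (c : O) * x ∈ J) : x ∈ J := by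
  have hu : IsUnit (c : O) := by
    have := (isUnit_iff_ne_zero.mpr (Int.cast_ne_zero.mpr hc : (c : K) ≠ 0)).map (algebraMap K O)
    simpa using this
  exact (J.unit_mul_mem_iff_mem hu).mp h

/-! ### The mixed jacobian ideal as a subresultant ideal. -/

/-- The ideal of the monomials of weight at least seven, for the weights `3` of `a` and `1` of `l`,
is contained in the product of the maximal ideal with the subresultant ideal. -/
theorem cusp_monomials_le (K : Type*) {O : Type*} [Field K] [CharZero K] [CommRing O]
    [IsLocalRing O] [Algebra K O] (a l k e : O)
    (hm : IsLocalRing.maximalIdeal O = Ideal.span {l, a}) :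
    Ideal.span {a ^ 2 * l, a * l ^ 4, l ^ 7, a ^ 3} ≤
      IsLocalRing.maximalIdeal O * Ideal.span {cuspLin a l k e, cuspConst a l k e} := by
  set W : Ideal O := Ideal.span {a ^ 2 * l, a * l ^ 4, l ^ 7, a ^ 3} with hW
  set I : Ideal O := Ideal.span {cuspLin a l k e, cuspConst a l k e} with hI
  have hS : cuspLin a l k e ∈ I ⊔ W := le_sup_left (a := I) (Ideal.subset_span (by simp))
  have hT : cuspConst a l k e ∈ I ⊔ W := le_sup_left (a := I) (Ideal.subset_span (by simp))
  have h₁ : a ^ 2 * l ∈ I ⊔ W := le_sup_right (a := I) (Ideal.subset_span (by simp))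
  have h₂ : a * l ^ 4 ∈ I ⊔ W := le_sup_right (a := I) (Ideal.subset_span (by simp))
  have h₃ : l ^ 7 ∈ I ⊔ W := le_sup_right (a := I) (Ideal.subset_span (by simp))
  have h₄ : a ^ 3 ∈ I ⊔ W := le_sup_right (a := I) (Ideal.subset_span (by simp))
  have ha : a ∈ IsLocalRing.maximalIdeal O := hm ▸ Ideal.subset_span (by simp)
  have hl : l ∈ IsLocalRing.maximalIdeal O := hm ▸ Ideal.subset_span (by simp)
  -- Nakayama's lemma: it suffices that `W ≤ 𝔪 I + 𝔪 W`.
  refine Submodule.le_of_le_smul_of_le_jacobson_bot (I := IsLocalRing.maximalIdeal O)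
    (Submodule.fg_span (Set.toFinite _))
    (IsLocalRing.maximalIdeal_le_jacobson _) ?_
  rw [smul_eq_mul, ← Ideal.mul_sup, hW, Ideal.span_le]
  have key {c : ℤ} {x y z : O} (hc : c ≠ 0) (h : (c : O) * x = a * y + l * z) (hy : y ∈ I ⊔ W)
      (hz : z ∈ I ⊔ W) : x ∈ IsLocalRing.maximalIdeal O * (I ⊔ W) :=
    Ideal.mem_of_intCast_mul_mem K c hc
      (h ▸ add_mem (Ideal.mul_mem_mul ha hy) (Ideal.mul_mem_mul hl hz))
  rintro x (rfl | rfl | rfl | rfl)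
  · refine key (c := -108) (by norm_num) (by push_cast; exact mul_sq_mul_eq_subres a l k e) ?_ ?_
    all_goals
      repeat' refine add_mem ?_ ?_
      all_goals exact Ideal.mul_mem_left _ _ (by assumption)
  · refine key (c := -24) (by norm_num) (by push_cast; exact mul_mul_pow_four_eq_subres a l k e) ?_ ?_
    all_goals
      repeat' refine add_mem ?_ ?_
      all_goals exact Ideal.mul_mem_left _ _ (by assumption)
  · refine key (c := -8) (by norm_num) (by push_cast; exact mul_pow_seven_eq_subres a l k e) ?_ ?_
    all_goals
      repeat' refine add_mem ?_ ?_
      all_goals exact Ideal.mul_mem_left _ _ (by assumption)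
  · refine key (c := 36) (by norm_num) (by push_cast; exact mul_cube_eq_subres a l k e) ?_ ?_
    all_goals
      repeat' refine add_mem ?_ ?_
      all_goals first | assumption | exact Ideal.mul_mem_left _ _ (by assumption)

/-- The mixed jacobian ideal of the curve `cuspDiscr a l 1 k e = 0` and its tangent curve `a = 0`,
with coefficient `-9`, is the subresultant ideal of the quartic `(a + l w + k w²)² + w³ + e w⁴`. -/
theorem mixedJacobianIdeal_cuspDiscr {K O : Type*} [Field K] [CharZero K] [CommRing O]
    [IsLocalRing O] [Algebra K O] {l a : O} {Dl Da : Derivation K O O}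
    (hD : IsPartialDerivatives l a Dl Da)
    (hJ : ∀ (x y : O) (D₁ D₂ : Derivation K O O), IsPartialDerivatives x y D₁ D₂ →
      ∃ δ : O, ∀ G H, D₁ G * D₂ H - D₂ G * D₁ H = δ * (Dl G * Da H - Da G * Dl H)) (κ ε : K) :
    mixedJacobianIdeal (Ideal.span {cuspDiscr a l 1 (algebraMap K O κ) (algebraMap K O ε)})
      (Ideal.span {a}) (-9 : K) (IsLocalRing.maximalIdeal O ^ 2) =
    Ideal.span {cuspLin a l (algebraMap K O κ) (algebraMap K O ε),
      cuspConst a l (algebraMap K O κ) (algebraMap K O ε)} := by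
  have hDU := fun D => derivation_cuspDiscr (k := K) (R := O) D a l κ ε
  obtain ⟨hm, h11, h12, h21, h22⟩ := id hD
  set k := algebraMap K O κ
  set e := algebraMap K O ε
  set U := cuspDiscr a l 1 k e with hU
  set Ul := cuspDiscrDl a l k e with hUl
  set Ua := cuspDiscrDa a l k e with hUa
  set I : Ideal O := Ideal.span {cuspLin a l k e, cuspConst a l k e} with hI
  set J := mixedJacobianIdeal (Ideal.span {U}) (Ideal.span {a}) (-9 : K)
    (IsLocalRing.maximalIdeal O ^ 2) with hJdef
  have hWmI := cusp_monomials_le K a l k e hm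
  have hWI := hWmI.trans Ideal.mul_le_right
  have h₁ := hWI (Ideal.subset_span (by simp : a ^ 2 * l ∈ _))
  have h₂ := hWI (Ideal.subset_span (by simp : a * l ^ 4 ∈ _))
  have h₃ := hWI (Ideal.subset_span (by simp : l ^ 7 ∈ _))
  have h₄ := hWI (Ideal.subset_span (by simp : a ^ 3 ∈ _))
  have hS : cuspLin a l k e ∈ I := Ideal.subset_span (by simp)
  have hT : cuspConst a l k e ∈ I := Ideal.subset_span (by simp)
  have hneg9 : algebraMap K O (-9) = -9 := by rw [map_neg, map_ofNat]
  apply le_antisymm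
  · rw [hJdef, mixedJacobianIdeal, Ideal.span_le]
    rintro _ ⟨x, y, D₁, D₂, hxy, F, hF, G, hG, H, hH, rfl⟩
    -- Both jacobians acquire the same factor `δ`, so the parameters `l, a` suffice.
    obtain ⟨δ, hδ⟩ := hJ x y D₁ D₂ hxy
    obtain ⟨f, rfl⟩ := Ideal.mem_span_singleton'.mp hF
    obtain ⟨g, rfl⟩ := Ideal.mem_span_singleton'.mp hG
    obtain ⟨x, y, z, rfl⟩ : ∃ x y z : O, H = x * l ^ 2 + y * (l * a) + z * a ^ 2 := by
      rw [pow_two, hm, Ideal.span_pair_mul_span_pair] at hH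
      obtain ⟨x, u, hu, rfl⟩ := Ideal.mem_span_insert.mp hH
      obtain ⟨y, v, hv, rfl⟩ := Ideal.mem_span_insert.mp hu
      obtain ⟨y', z, rfl⟩ := Ideal.mem_span_pair.mp hv
      exact ⟨x, y + y', z, by ring⟩
    have hlS : l * cuspLin a l k e ∈ I := Ideal.mul_mem_left _ _ hS
    have hlV : l * (9 * U - a * Ua) ∈ I := by
      refine Ideal.mem_of_intCast_mul_mem K 2 (by norm_num) ?_
      rw [Int.cast_ofNat, ← mul_assoc, mixedJacobian_sq_eq]
      repeat' refine add_mem ?_ ?_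
      all_goals exact Ideal.mul_mem_left _ _ (by assumption)
    have haV : a * (9 * U - a * Ua) + a * l * Ul ∈ I := by
      rw [mixedJacobian_mul_eq]
      repeat' refine add_mem ?_ ?_
      all_goals exact Ideal.mul_mem_left _ _ (by assumption)
    obtain ⟨p, q, hpq⟩ := exists_cuspDiscr_eq a l k e
    obtain ⟨r, s, hrs⟩ := exists_cuspDiscrDl_eq a l k e
    rw [← hU] at hpq
    rw [← hUl] at hrs
    -- These products have weight at least 7; together with the generators for `l²` and `a l` they
    -- account for every term below.
    have haaU : a ^ 2 * U ∈ I := by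
      rw [show a ^ 2 * U = l ^ 2 * p * (a ^ 2 * l) + q * a ^ 3 by rw [hpq]; ring]
      exact add_mem (Ideal.mul_mem_left _ _ h₁) (Ideal.mul_mem_left _ _ h₄)
    have halU : a * l * U ∈ I := by
      rw [show a * l * U = p * (a * l ^ 4) + q * (a ^ 2 * l) by rw [hpq]; ring]
      exact add_mem (Ideal.mul_mem_left _ _ h₂) (Ideal.mul_mem_left _ _ h₁)
    have haaUl : a ^ 2 * Ul ∈ I := by
      rw [show a ^ 2 * Ul = l * r * (a ^ 2 * l) + s * a ^ 3 by rw [hrs]; ring]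
      exact add_mem (Ideal.mul_mem_left _ _ h₁) (Ideal.mul_mem_left _ _ h₄)
    have hallUl : a * l ^ 2 * Ul ∈ I := by
      rw [show a * l ^ 2 * Ul = r * (a * l ^ 4) + l * s * (a ^ 2 * l) by rw [hrs]; ring]
      exact add_mem (Ideal.mul_mem_left _ _ h₂) (Ideal.mul_mem_left _ _ h₁)
    have haaV : a ^ 2 * (9 * U - a * Ua) ∈ I := by
      rw [show a ^ 2 * (9 * U - a * Ua) = 9 * (a ^ 2 * U) - Ua * a ^ 3 by ring]
      exact sub_mem (Ideal.mul_mem_left _ _ haaU) (Ideal.mul_mem_left _ _ h₄)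
    set H := x * l ^ 2 + y * (l * a) + z * a ^ 2 with hH
    rw [hδ, hδ, hneg9]
    have hDl : Dl H = 2 * x * l + y * a + (Dl x * l ^ 2 + Dl y * (l * a) + Dl z * a ^ 2) := by
      simp only [hH, map_add, Derivation.leibniz, Derivation.leibniz_pow, h11, h12, smul_eq_mul,
        nsmul_eq_mul]
      push_cast
      ring
    have hDa : Da H = y * l + 2 * z * a + (Da x * l ^ 2 + Da y * (l * a) + Da z * a ^ 2) := by
      simp only [hH, map_add, Derivation.leibniz, Derivation.leibniz_pow, h21, h22, smul_eq_mul,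
        nsmul_eq_mul]
      push_cast
      ring
    -- The Leibniz rule separates the derivatives of `U` and `a` from those of the multipliers `f`
    -- and `g`. The latter only contribute multiples of `a l U` and `a² U`.
    have key : δ * (Dl (f * U) * Da H - Da (f * U) * Dl H) * (g * a)
          + -9 * (f * U) * (δ * (Dl (g * a) * Da H - Da (g * a) * Dl H)) =
        δ * f * g * ((2 * x + Dl x * l + Dl y * a) * (l * (9 * U - a * Ua))
          + y * (a * (9 * U - a * Ua) + a * l * Ul) + Dl z * (a ^ 2 * (9 * U - a * Ua))
          + (2 * z + Da y * l + Da z * a) * (a ^ 2 * Ul)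
          + Da x * (a * l ^ 2 * Ul))
        + δ * (g * Dl f - 9 * f * Dl g) * ((y + Da x * l + Da y * a) * (a * l * U)
          + (2 * z + Da z * a) * (a ^ 2 * U))
        - δ * (g * Da f - 9 * f * Da g) * ((2 * x + Dl x * l + Dl y * a) * (a * l * U)
          + (y + Dl z * a) * (a ^ 2 * U)) := by
      simp only [Derivation.leibniz, hDU, h11, h12, h21, h22, smul_eq_mul, hDl, hDa]
      ring
    rw [key]
    refine sub_mem (add_mem ?_ ?_) ?_ <;> refine Ideal.mul_mem_left _ _ ?_
    all_goals
      repeat' refine add_mem ?_ ?_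
      all_goals exact Ideal.mul_mem_left _ _ (by assumption)
  · have hJmem (H : O) (hH : H ∈ IsLocalRing.maximalIdeal O ^ 2) :
        (Ul * Da H - Ua * Dl H) * a + 9 * U * Dl H ∈ J := by
      rw [hJdef]
      refine Ideal.subset_span ⟨l, a, Dl, Da, hD, U, Ideal.subset_span rfl, a,
        Ideal.subset_span rfl, H, hH, ?_⟩
      simp only [hDU, h11, h12, h21, h22, hneg9]
      ring
    have ha : a ∈ IsLocalRing.maximalIdeal O := hm ▸ Ideal.subset_span (by simp)
    have hl : l ∈ IsLocalRing.maximalIdeal O := hm ▸ Ideal.subset_span (by simp)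
    have hJ₁ : 2 * l * (9 * U - a * Ua) ∈ J := by
      convert hJmem (l ^ 2) (Ideal.pow_mem_pow hl 2) using 1
      simp only [Derivation.leibniz_pow, h11, h21, smul_eq_mul, nsmul_eq_mul]
      push_cast
      ring
    have hJ₂ : a * (9 * U - a * Ua) + a * l * Ul ∈ J := by
      convert hJmem (a * l) (pow_two (IsLocalRing.maximalIdeal O) ▸ Ideal.mul_mem_mul ha hl) using 1
      simp only [Derivation.leibniz, h11, h12, h21, h22, smul_eq_mul]
      ring
    set mI := IsLocalRing.maximalIdeal O * I with hmI
    have g₁ := hWmI (Ideal.subset_span (by simp : a ^ 2 * l ∈ _))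
    have g₂ := hWmI (Ideal.subset_span (by simp : a * l ^ 4 ∈ _))
    have g₃ := hWmI (Ideal.subset_span (by simp : l ^ 7 ∈ _))
    have g₄ := hWmI (Ideal.subset_span (by simp : a ^ 3 ∈ _))
    have hlS : l * cuspLin a l k e ∈ mI := Ideal.mul_mem_mul hl hS
    rw [mixedJacobian_sq_eq] at hJ₁
    rw [mixedJacobian_mul_eq] at hJ₂
    -- Modulo `𝔪 I` the remainders of weight at least 7 vanish. `cuspConst` comes before `cuspLin`,
    -- because it occurs in the identity for `H = l²` with a coefficient that need not lie in `𝔪`.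
    have hT' : cuspConst a l k e ∈ J ⊔ mI := by
      refine Ideal.mem_of_intCast_mul_mem K (-6) (by norm_num) ?_
      have h := Ideal.mem_sup_left (T := mI) hJ₂
      simp only [add_assoc] at h
      rw [(J ⊔ mI).add_mem_iff_left (Ideal.mem_sup_right ?_)] at h
      · simpa using h
      · repeat' refine add_mem ?_ ?_
        all_goals exact Ideal.mul_mem_left _ _ (by assumption)
    have hS' : cuspLin a l k e ∈ J ⊔ mI := by
      refine Ideal.mem_of_intCast_mul_mem K (-9) (by norm_num) ?_
      have h := Ideal.mem_sup_left (T := mI) hJ₁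
      simp only [add_assoc] at h
      rw [(J ⊔ mI).add_mem_iff_left (add_mem (Ideal.mem_sup_right (Ideal.mul_mem_left _ _ hlS))
        (add_mem (Ideal.mul_mem_left _ _ hT') (Ideal.mem_sup_right ?_)))] at h
      · simpa using h
      · repeat' refine add_mem ?_ ?_
        all_goals exact Ideal.mul_mem_left _ _ (by assumption)
    refine Submodule.le_of_le_smul_of_le_jacobson_bot (I := IsLocalRing.maximalIdeal O)
      (Submodule.fg_span (Set.toFinite _))
      (IsLocalRing.maximalIdeal_le_jacobson _) ?_
    rw [smul_eq_mul, ← hmI]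
    conv_lhs => rw [hI]
    rw [Ideal.span_le]
    rintro x (rfl | rfl)
    · exact hS'
    · exact hT'

/-! ### The conductor for a quartic polynomial. -/

open Polynomial in
theorem derivative_quartic {R : Type*} [CommRing R] (f₀ f₁ f₂ f₃ f₄ : R) :
    derivative (quartic f₀ f₁ f₂ f₃ f₄) =
      C f₁ + 2 * C f₂ * X + 3 * C f₃ * X ^ 2 + 4 * C f₄ * X ^ 3 := by
  simp only [quartic, derivative_add, derivative_C, derivative_mul, derivative_X,
    derivative_X_pow]
  norm_num
  simp only [map_ofNat]
  ring

theorem map_quartic {R S : Type*} [CommRing R] [CommRing S] (φ : R →+* S) (f₀ f₁ f₂ f₃ f₄ : R) :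
    (quartic f₀ f₁ f₂ f₃ f₄).map φ = quartic (φ f₀) (φ f₁) (φ f₂) (φ f₃) (φ f₄) := by
  simp [quartic]

section QuarticSubresultants

variable {R : Type*} [CommRing R]

open Polynomial in
/-- The quadratic subresultant of the quartic `f = f₀ + f₁ w + f₂ w² + f₃ w³ + f₄ w⁴`, up to a
constant. -/
noncomputable def quarticSubresQuad (f₀ f₁ f₂ f₃ f₄ : R) : R[X] :=
  C (8 * f₄ * f₂ - 3 * f₃ ^ 2) * X ^ 2 + C (12 * f₄ * f₁ - 2 * f₂ * f₃) * X
    + C (16 * f₄ * f₀ - f₃ * f₁)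

open Polynomial in
theorem quarticSubresQuad_eq (f₀ f₁ f₂ f₃ f₄ : R) :
    quarticSubresQuad f₀ f₁ f₂ f₃ f₄ =
      16 * C f₄ * quartic f₀ f₁ f₂ f₃ f₄
        - (4 * C f₄ * X + C f₃) * derivative (quartic f₀ f₁ f₂ f₃ f₄) := by
  rw [derivative_quartic, quarticSubresQuad, quartic]
  simp only [map_sub, map_mul, map_pow, map_ofNat]
  ring

open Polynomial in
-- The dividend `4 f - w f'` is the cubic `4f₀ + 3f₁w + 2f₂w² + f₃w³`. Its pseudoremainder by the
-- quadratic subresultant is linear in `w` and gives the relation between `1` and `w`.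
theorem quarticSubresLin_mul_X_add_eq (f₀ f₁ f₂ f₃ f₄ : R) :
    C (quarticSubresLin f₀ f₁ f₂ f₃ f₄) * X + C (quarticSubresConst f₀ f₁ f₂ f₃ f₄) =
      C (8 * f₄ * f₂ - 3 * f₃ ^ 2) ^ 2
        * (4 * quartic f₀ f₁ f₂ f₃ f₄ - X * derivative (quartic f₀ f₁ f₂ f₃ f₄))
      - (C (f₃ * (8 * f₄ * f₂ - 3 * f₃ ^ 2)) * X
          + C (2 * f₂ * (8 * f₄ * f₂ - 3 * f₃ ^ 2) - f₃ * (12 * f₄ * f₁ - 2 * f₂ * f₃)))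
        * quarticSubresQuad f₀ f₁ f₂ f₃ f₄ := by
  rw [derivative_quartic, quarticSubresQuad, quartic, quarticSubresLin, quarticSubresConst]
  simp only [map_sub, map_mul, map_pow, map_ofNat]
  ring

variable {f₀ f₁ f₂ f₃ f₄ d : R}

open Polynomial in
/-- A linear polynomial in the ideal generated by a quartic and its derivative has its coefficients
in the subresultant ideal. -/
theorem mem_span_subres_of_linear_mem (h4 : IsUnit (4 : R)) (hf₃ : IsUnit f₃)
    (hu : IsUnit (8 * f₄ * f₂ - 3 * f₃ ^ 2)) {g c : R}
    (hgc : C g * X + C c ∈ Ideal.span {quartic f₀ f₁ f₂ f₃ f₄,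
      derivative (quartic f₀ f₁ f₂ f₃ f₄)}) :
    g ∈ Ideal.span {quarticSubresLin f₀ f₁ f₂ f₃ f₄, quarticSubresConst f₀ f₁ f₂ f₃ f₄} := by
  set I := Ideal.span {quarticSubresLin f₀ f₁ f₂ f₃ f₄, quarticSubresConst f₀ f₁ f₂ f₃ f₄} with hI
  set φ := Ideal.Quotient.mk I
  have hS : φ (quarticSubresLin f₀ f₁ f₂ f₃ f₄) = 0 :=
    Ideal.Quotient.eq_zero_iff_mem.mpr (Ideal.subset_span (by simp))
  have hT : φ (quarticSubresConst f₀ f₁ f₂ f₃ f₄) = 0 :=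
    Ideal.Quotient.eq_zero_iff_mem.mpr (Ideal.subset_span (by simp))
  set f := (quartic f₀ f₁ f₂ f₃ f₄).map φ with hf
  set r := (quarticSubresQuad f₀ f₁ f₂ f₃ f₄).map φ with hr
  have e₁ := congrArg (Polynomial.map φ) (quarticSubresQuad_eq f₀ f₁ f₂ f₃ f₄)
  have e₂ := congrArg (Polynomial.map φ) (quarticSubresLin_mul_X_add_eq f₀ f₁ f₂ f₃ f₄)
  simp only [Polynomial.map_add, Polynomial.map_sub, Polynomial.map_mul, Polynomial.map_pow,
    map_C, map_X, Polynomial.map_ofNat, hS, hT, map_zero, zero_mul, zero_add,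
    ← derivative_map, ← hf, ← hr] at e₁ e₂
  -- Modulo `(S, T)` the linear remainder vanishes, so the Euclidean algorithm stops at the
  -- quadratic `r`, which therefore divides `f` and `f'`.
  have hp : r ∣ 4 * f - X * derivative f := by
    have hu' : IsUnit (C (φ (8 * f₄ * f₂ - 3 * f₃ ^ 2)) ^ 2) := ((hu.map φ).map C).pow 2
    rw [← hu'.dvd_mul_left]
    exact ⟨_, (sub_eq_zero.mp e₂.symm).trans (mul_comm _ _)⟩
  have hf' : r ∣ derivative f := by
    have hu' : IsUnit (C (φ f₃)) := (hf₃.map φ).map C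
    rw [← hu'.dvd_mul_left]
    have : C (φ f₃) * derivative f = 4 * C (φ f₄) * (4 * f - X * derivative f) - r := by
      rw [e₁]; ring
    rw [this]
    exact dvd_sub (hp.mul_left _) dvd_rfl
  have hff : r ∣ f := by
    have hu' : IsUnit (4 : (R ⧸ I)[X]) := by
      have := (h4.map φ).map (C : R ⧸ I →+* (R ⧸ I)[X])
      rwa [map_ofNat, map_ofNat] at this
    rw [← hu'.dvd_mul_left]
    have : 4 * f = (4 * f - X * derivative f) + X * derivative f := by ring
    rw [this]
    exact dvd_add hp (hf'.mul_left _)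
  have hdvd : r ∣ C (φ g) * X + C (φ c) := by
    have h := Ideal.mem_map_of_mem (Polynomial.mapRingHom φ) hgc
    rw [Ideal.map_span, Set.image_pair] at h
    simp only [coe_mapRingHom, ← derivative_map, Polynomial.map_add, Polynomial.map_mul, map_C,
      map_X, ← hf] at h
    obtain ⟨x, y, hxy⟩ := Ideal.mem_span_pair.mp h
    rw [← hxy]
    exact dvd_add (hff.mul_left _) (hf'.mul_left _)
  obtain ⟨h, hh⟩ := hdvd
  rw [← Ideal.Quotient.eq_zero_iff_mem]
  change φ g = 0
  rcases subsingleton_or_nontrivial (R ⧸ I) with _ | _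
  · exact Subsingleton.elim _ _
  have hlead : r.coeff 2 = φ (8 * f₄ * f₂ - 3 * f₃ ^ 2) := by
    simp only [hr, quarticSubresQuad, coeff_map, coeff_add, coeff_C_mul, coeff_X_pow, coeff_X,
      coeff_C]
    simp
  have hrdeg : r.natDegree = 2 := by
    refine natDegree_eq_of_le_of_coeff_ne_zero ?_ ?_
    · rw [hr, quarticSubresQuad]
      simp only [Polynomial.map_add, Polynomial.map_mul, Polynomial.map_pow, map_C, map_X]
      compute_degree
    · rw [hlead]
      exact (hu.map φ).ne_zero
  have hreg : r.leadingCoeff ∈ nonZeroDivisors (R ⧸ I) := by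
    rw [leadingCoeff, hrdeg, hlead]
    exact (hu.map φ).mem_nonZeroDivisors
  -- A nonzero multiple of a quadratic polynomial with unit leading coefficient cannot be linear.
  have h0 : h = 0 := by
    by_contra h0
    have h1 : (r * h).natDegree = r.natDegree + h.natDegree :=
      natDegree_mul' (fun h' => h0 (leadingCoeff_eq_zero.mp
        ((mul_left_mem_nonZeroDivisors_eq_zero_iff hreg).mp h')))
    have h2 : (C (φ g) * X + C (φ c)).natDegree ≤ 1 := by compute_degree
    rw [hh, h1, hrdeg] at h2
    omega
  rw [h0, mul_zero] at hh
  simpa using congrArg (fun p => p.coeff 1) hh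

open Polynomial in
/-- The conductor of `O / (d)` in `O[w] / (f, f')`, for a quartic `f` with an unramified quadratic
subresultant, is the ideal generated by the coefficients of a linear subresultant. -/
theorem comap_conductorIdeal_criticalMap_quartic (h4 : IsUnit (4 : R)) (hf₃ : IsUnit f₃)
    (hu : IsUnit (8 * f₄ * f₂ - 3 * f₃ ^ 2)) {f : R[X]} (hf : f = quartic f₀ f₁ f₂ f₃ f₄)
    (h : C d ∈ Ideal.span {f, derivative f}) :
    (conductorIdeal (criticalMap d f h)).comap (Ideal.Quotient.mk _) =
      Ideal.span {quarticSubresLin f₀ f₁ f₂ f₃ f₄, quarticSubresConst f₀ f₁ f₂ f₃ f₄} := by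
  subst hf
  set f := quartic f₀ f₁ f₂ f₃ f₄ with hf
  set N : Ideal R[X] := Ideal.span {f, derivative f} with hN
  let ψ : R[X] →+* R[X] ⧸ N := Ideal.Quotient.mk N
  have hφ : ∀ x : R, criticalMap d f h (Ideal.Quotient.mk _ x) = ψ (C x) := fun x => rfl
  have hψf : ψ f = 0 := Ideal.Quotient.eq_zero_iff_mem.mpr (Ideal.subset_span (by simp))
  have hψf' : ψ (derivative f) = 0 :=
    Ideal.Quotient.eq_zero_iff_mem.mpr (Ideal.subset_span (by simp))
  obtain ⟨v, hv⟩ := hu.exists_left_inv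
  have hvψ : ψ (C v) * ψ (C (8 * f₄ * f₂ - 3 * f₃ ^ 2)) = 1 := by
    rw [← map_mul, ← map_mul, hv, map_one, map_one]
  have hquad := congrArg ψ (quarticSubresQuad_eq f₀ f₁ f₂ f₃ f₄)
  have hlin := congrArg ψ (quarticSubresLin_mul_X_add_eq f₀ f₁ f₂ f₃ f₄)
  rw [← hf] at hquad hlin
  have hq0 : ψ (quarticSubresQuad f₀ f₁ f₂ f₃ f₄) = 0 := by
    rw [hquad]
    simp only [map_sub, map_mul ψ, hψf, hψf', mul_zero, sub_zero]
  have hl0 : ψ (C (quarticSubresLin f₀ f₁ f₂ f₃ f₄)) * ψ X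
      + ψ (C (quarticSubresConst f₀ f₁ f₂ f₃ f₄)) = 0 := by
    rw [← map_mul, ← map_add, hlin]
    simp only [map_sub ψ, map_mul ψ, hq0, hψf, hψf', mul_zero, sub_zero]
  rw [quarticSubresQuad, map_add, map_add, map_mul, map_mul, map_pow] at hq0
  have hX2 : ψ X ^ 2 = - (ψ (C v) * ψ (C (12 * f₄ * f₁ - 2 * f₂ * f₃))) * ψ X
      - ψ (C v) * ψ (C (16 * f₄ * f₀ - f₃ * f₁)) := by
    linear_combination ψ (C v) * hq0 - ψ X ^ 2 * hvψ
  -- The quadratic relation reduces all powers of `w`, so `1` and `w` generate the ring as a module.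
  have hgen : ∀ b : R[X] ⧸ N, ∃ x y : R, b = ψ (C x) + ψ (C y) * ψ X := by
    intro b
    obtain ⟨p, rfl⟩ := Ideal.Quotient.mk_surjective b
    change ∃ x y, ψ p = _
    induction p using Polynomial.induction_on' with
    | add p q hp hq =>
      obtain ⟨x, y, hp⟩ := hp
      obtain ⟨x', y', hq⟩ := hq
      refine ⟨x + x', y + y', ?_⟩
      simp only [map_add, hp, hq]
      ring
    | monomial n c =>
      rw [← C_mul_X_pow_eq_monomial, map_mul, map_pow]
      obtain ⟨x, y, hxy⟩ : ∃ x y, ψ X ^ n = ψ (C x) + ψ (C y) * ψ X := by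
        induction n with
        | zero => exact ⟨1, 0, by simp⟩
        | succ n ih =>
          obtain ⟨x, y, hxy⟩ := ih
          refine ⟨-y * v * (16 * f₄ * f₀ - f₃ * f₁), x - y * v * (12 * f₄ * f₁ - 2 * f₂ * f₃), ?_⟩
          rw [pow_succ, hxy, add_mul, mul_assoc, ← pow_two, hX2]
          simp only [map_mul, map_sub, map_neg]
          ring
      exact ⟨c * x, c * y, by rw [hxy]; simp only [map_mul]; ring⟩
  apply le_antisymm
  · intro g hg
    -- Testing `g` on `w` alone puts a linear polynomial `g w - c` into `(f, f')`.
    obtain ⟨c, hc⟩ := hg (ψ X)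
    obtain ⟨c, rfl⟩ := Ideal.Quotient.mk_surjective c
    rw [hφ, hφ, ← map_mul] at hc
    refine mem_span_subres_of_linear_mem (c := -c) h4 hf₃ hu ?_
    rw [C_neg, ← sub_eq_add_neg]
    exact Ideal.Quotient.eq.mp hc
  · rw [Ideal.span_le]
    set S := quarticSubresLin f₀ f₁ f₂ f₃ f₄
    set T := quarticSubresConst f₀ f₁ f₂ f₃ f₄
    rintro g (rfl | rfl) b
    · obtain ⟨x, y, rfl⟩ := hgen b
      refine ⟨Ideal.Quotient.mk _ (S * x - y * T), ?_⟩
      rw [hφ, hφ]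
      simp only [map_mul, map_sub]
      linear_combination ψ (C y) * hl0
    · obtain ⟨x, y, rfl⟩ := hgen b
      -- With `w² = -α w - β`, the relation `S w + T = 0` gives `T w = -S w² = -α T + β S`.
      refine ⟨Ideal.Quotient.mk _ (T * x + y * (- v * (12 * f₄ * f₁ - 2 * f₂ * f₃) * T
        + v * (16 * f₄ * f₀ - f₃ * f₁) * S)), ?_⟩
      rw [hφ, hφ]
      simp only [map_mul, map_sub, map_add, map_neg] at hl0 hX2 ⊢
      linear_combination ψ (C y) * (ψ X + ψ (C v) * (ψ (C 12) * ψ (C f₄) * ψ (C f₁)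
        - ψ (C 2) * ψ (C f₂) * ψ (C f₃))) * hl0 - ψ (C y) * ψ (C S) * hX2

end QuarticSubresultants

/-! ### Derivations and changes of parameters. -/

section LocalizedDerivations

open TensorProduct

/-- A derivation extends to a localization. -/
theorem Derivation.exists_of_isLocalization {k R S : Type*} [CommRing k] [CommRing R] [CommRing S]
    [Algebra k R] [Algebra k S] [Algebra R S] [IsScalarTower k R S] (M : Submonoid R)
    [IsLocalization M S] (D : Derivation k R R) :
    ∃ D' : Derivation k S S, ∀ r, D' (algebraMap R S r) = algebraMap R S (D r) := by
  have : Algebra.FormallyEtale R S := Algebra.FormallyEtale.of_isLocalization M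
  refine ⟨((LinearMap.liftBaseChange S ((Algebra.linearMap R S).comp
    D.liftKaehlerDifferential)).comp
      (KaehlerDifferential.tensorKaehlerEquivOfFormallyEtale k R S).symm.toLinearMap).compDer
        (KaehlerDifferential.D k S), fun r => ?_⟩
  simp [KaehlerDifferential.tensorKaehlerEquivOfFormallyEtale_symm_D_algebraMap]

theorem Derivation.ext_of_isLocalization {k R S : Type*} [CommRing k] [CommRing R] [CommRing S]
    [Algebra k S] [Algebra R S] (M : Submonoid R) [IsLocalization M S] {D₁ D₂ : Derivation k S S}
    (h : ∀ r, D₁ (algebraMap R S r) = D₂ (algebraMap R S r)) : D₁ = D₂ := by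
  ext x
  obtain ⟨r, s, rfl⟩ := IsLocalization.exists_mk'_eq M x
  have hx := IsLocalization.mk'_spec S r s
  have h₁ := congrArg D₁ hx
  have h₂ := congrArg D₂ hx
  rw [Derivation.leibniz, smul_eq_mul, smul_eq_mul, h] at h₁
  rw [Derivation.leibniz, smul_eq_mul, smul_eq_mul, ← h r, ← h₁] at h₂
  exact (IsLocalization.map_units S s).mul_left_cancel (add_left_cancel h₂).symm

end LocalizedDerivations

/-- A second pair of generators of the maximal ideal also has partial derivatives, and the jacobian
determinants for different systems of parameters are proportional. -/
theorem IsPartialDerivatives.exists_of_maximalIdeal_eq {k O : Type*} [CommRing k] [CommRing O]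
    [IsLocalRing O] [Algebra k O] {ξ η : O} {D₀ D₁ : Derivation k O O}
    (hD : IsPartialDerivatives ξ η D₀ D₁) (hspan : ∀ D : Derivation k O O, D = D ξ • D₀ + D η • D₁)
    {x y : O} (hm : IsLocalRing.maximalIdeal O = Ideal.span {x, y}) :
    ∃ E₁ E₂ : Derivation k O O, IsPartialDerivatives x y E₁ E₂ ∧
      ∀ (x' y' : O) (D₁ D₂ : Derivation k O O), IsPartialDerivatives x' y' D₁ D₂ →
        ∃ δ : O, ∀ G H, D₁ G * D₂ H - D₂ G * D₁ H = δ * (E₁ G * E₂ H - E₂ G * E₁ H) := by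
  obtain ⟨hm', h11, h12, h21, h22⟩ := hD
  have hx : x ∈ IsLocalRing.maximalIdeal O := hm ▸ Ideal.subset_span (by simp)
  have hy : y ∈ IsLocalRing.maximalIdeal O := hm ▸ Ideal.subset_span (by simp)
  obtain ⟨α, β, hξ⟩ := Ideal.mem_span_pair.mp
    (hm ▸ hm' ▸ Ideal.subset_span (by simp) : ξ ∈ Ideal.span {x, y})
  obtain ⟨γ, ε, hη⟩ := Ideal.mem_span_pair.mp
    (hm ▸ hm' ▸ Ideal.subset_span (by simp) : η ∈ Ideal.span {x, y})
  have e11 := congrArg D₀ hξ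
  have e12 := congrArg D₀ hη
  have e21 := congrArg D₁ hξ
  have e22 := congrArg D₁ hη
  simp only [map_add, Derivation.leibniz, smul_eq_mul, h11, h12, h21, h22] at e11 e12 e21 e22
  set J := D₀ x * D₁ y - D₀ y * D₁ x with hJ
  have hu : IsUnit J := by
    by_contra h
    have hJm : J ∈ IsLocalRing.maximalIdeal O := h
    refine (IsLocalRing.maximalIdeal.isMaximal O).ne_top ((Ideal.eq_top_iff_one _).mpr ?_)
    -- Modulo `𝔪`, differentiating `ξ = αx + βy` and `η = γx + εy` shows that the two jacobian
    -- matrices are inverse to each other.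
    have h1 : (1 : O) = (α * ε - β * γ) * J
        + (x * (D₀ α + (α * D₀ x + β * D₀ y) * D₁ γ - D₁ α * (γ * D₀ x + ε * D₀ y))
          + y * (D₀ β + (α * D₀ x + β * D₀ y) * D₁ ε - D₁ β * (γ * D₀ x + ε * D₀ y))) := by
      rw [hJ]
      linear_combination (-1 : O) * e11 - (α * D₀ x + β * D₀ y) * e22
        + (γ * D₀ x + ε * D₀ y) * e21
    rw [h1]
    exact add_mem (Ideal.mul_mem_left _ _ hJm)
      (add_mem (Ideal.mul_mem_right _ _ hx) (Ideal.mul_mem_right _ _ hy))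
  obtain ⟨v, hv⟩ := hu.exists_left_inv
  -- Cramer's rule for the inverse of the jacobian matrix.
  refine ⟨v • (D₁ y • D₀ - D₀ y • D₁), v • (D₀ x • D₁ - D₁ x • D₀), ⟨hm, ?_, ?_, ?_, ?_⟩, ?_⟩
  · simp only [Derivation.smul_apply, Derivation.sub_apply, smul_eq_mul]
    linear_combination hv
  · simp only [Derivation.smul_apply, Derivation.sub_apply, smul_eq_mul]
    ring
  · simp only [Derivation.smul_apply, Derivation.sub_apply, smul_eq_mul]
    ring
  · simp only [Derivation.smul_apply, Derivation.sub_apply, smul_eq_mul]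
    linear_combination hv
  · intro x' y' D D' _
    refine ⟨(D ξ * D' η - D η * D' ξ) * J, fun G H => ?_⟩
    rw [hspan D, hspan D']
    simp only [Derivation.smul_apply, Derivation.add_apply, Derivation.sub_apply, smul_eq_mul, h11,
      h12, h21, h22]
    linear_combination (-(D ξ * D' η - D η * D' ξ) * (D₀ G * D₁ H - D₁ G * D₀ H)) *
      ((v * J + 1) * hv)

/-! ### Lengths of quotients. -/

section Length

/-- If `J ⊆ I` are ideals of a local ring with `I = J + (g)` and `𝔪 g ⊆ J`, but `g ∉ J`, then the
lengths of the residue rings differ by one. -/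
theorem IsLocalRing.length_quotient_eq_add_one {O : Type*} [CommRing O] [IsLocalRing O]
    {I J : Ideal O} {g : O} (hI : I = J ⊔ Ideal.span {g}) (hg : g ∉ J)
    (hm : ∀ x ∈ IsLocalRing.maximalIdeal O, x * g ∈ J) :
    Module.length O (O ⧸ J) = Module.length O (O ⧸ I) + 1 := by
  have hJI : J ≤ I := hI ▸ le_sup_left
  -- Multiplication by `g` identifies the residue field with the kernel of `O/J → O/I`.
  let f : (O ⧸ IsLocalRing.maximalIdeal O) →ₗ[O] (O ⧸ J) :=
    Submodule.mapQ _ _ (LinearMap.toSpanSingleton O O g) fun x hx => hm x hx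
  let p : (O ⧸ J) →ₗ[O] (O ⧸ I) := Submodule.factor hJI
  have hinj : Function.Injective f := by
    rw [← LinearMap.ker_eq_bot, LinearMap.ker_eq_bot']
    intro x hx
    obtain ⟨x, rfl⟩ := Ideal.Quotient.mk_surjective x
    have hxg : x * g ∈ J := Ideal.Quotient.eq_zero_iff_mem.mp hx
    rw [Ideal.Quotient.eq_zero_iff_mem]
    by_contra hxm
    have hu : IsUnit x := by simpa using hxm
    exact hg ((J.unit_mul_mem_iff_mem hu).mp hxg)
  have hex : Function.Exact f p := by
    intro y
    obtain ⟨y, rfl⟩ := Ideal.Quotient.mk_surjective y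
    constructor
    · intro hy
      have hy' : y ∈ J ⊔ Ideal.span {g} := hI ▸ Ideal.Quotient.eq_zero_iff_mem.mp hy
      obtain ⟨j, hj, c, hc, rfl⟩ := Submodule.mem_sup.mp hy'
      obtain ⟨c, rfl⟩ := Ideal.mem_span_singleton'.mp hc
      refine ⟨Ideal.Quotient.mk _ c, Ideal.Quotient.eq.mpr ?_⟩
      change c * g - (j + c * g) ∈ J
      simpa using hj
    · rintro ⟨c, hc⟩
      obtain ⟨c, rfl⟩ := Ideal.Quotient.mk_surjective c
      have h : c * g - y ∈ J := Ideal.Quotient.eq.mp hc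
      refine Ideal.Quotient.eq_zero_iff_mem.mpr ?_
      have : y = c * g - (c * g - y) := by ring
      rw [this]
      exact sub_mem (hI ▸ Ideal.mem_sup_right (Ideal.mul_mem_left _ _ (Ideal.subset_span rfl)))
        (hJI h)
  rw [Module.length_eq_add_of_exact f p hinj (Submodule.factor_surjective hJI) hex, add_comm]
  congr 1
  rw [Module.length_eq_one_iff, isSimpleModule_iff_isCoatom]
  exact Ideal.isMaximal_def.mp (IsLocalRing.maximalIdeal.isMaximal O)

/-- Each step of the chain `(1) ⊃ (x, y) ⊃ (x², y) ⊃ (x³, y)` has length one. Strictness is detected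
by `D₁`, which kills `y`: `n` applications send `xⁿ` to `n!`, a unit in characteristic zero, but
send `(xⁿ⁺¹, y)` into `𝔪`. -/
theorem IsPartialDerivatives.length_quotient_span_pow_three {k O : Type*} [Field k] [CharZero k]
    [CommRing O] [IsLocalRing O] [Algebra k O] {x y : O} {D₁ D₂ : Derivation k O O}
    (hD : IsPartialDerivatives x y D₁ D₂) :
    Module.length O (O ⧸ Ideal.span {x ^ 3, y}) = 3 := by
  obtain ⟨hm, h11, h12, -, -⟩ := hD
  have hx : x ∈ IsLocalRing.maximalIdeal O := hm ▸ Ideal.subset_span (by simp)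
  have hy : y ∈ IsLocalRing.maximalIdeal O := hm ▸ Ideal.subset_span (by simp)
  have h1m : (1 : O) ∉ IsLocalRing.maximalIdeal O :=
    (Ideal.ne_top_iff_one _).mp (IsLocalRing.maximalIdeal.isMaximal O).ne_top
  have hmul : ∀ n, ∀ z ∈ IsLocalRing.maximalIdeal O, z * x ^ n ∈ Ideal.span {x ^ (n + 1), y} := by
    intro n z hz
    rw [hm] at hz
    obtain ⟨a, b, rfl⟩ := Ideal.mem_span_pair.mp hz
    exact Ideal.mem_span_pair.mpr ⟨a, b * x ^ n, by ring⟩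
  have hsup : ∀ n, Ideal.span {x ^ n, y} = Ideal.span {x ^ (n + 1), y} ⊔ Ideal.span {x ^ n} := by
    intro n
    refine le_antisymm (Ideal.span_le.mpr ?_) (sup_le (Ideal.span_le.mpr ?_) (Ideal.span_le.mpr ?_))
    · rintro z (rfl | rfl)
      · exact Ideal.mem_sup_right (Ideal.subset_span rfl)
      · exact Ideal.mem_sup_left (Ideal.subset_span (by simp))
    · rintro z (rfl | rfl)
      · exact pow_succ' x n ▸ Ideal.mul_mem_left _ _ (Ideal.subset_span (by simp))
      · exact Ideal.subset_span (by simp)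
    · rintro z rfl
      exact Ideal.subset_span (by simp)
  have hy0 : ∀ b : O, D₁ (b * y) = y * D₁ b := by
    intro b; rw [Derivation.leibniz, h12, smul_zero, zero_add, smul_eq_mul]
  have hnot1 : x ^ 1 ∉ Ideal.span {x ^ 2, y} := by
    intro h
    obtain ⟨a, b, hab⟩ := Ideal.mem_span_pair.mp h
    have h' := congrArg D₁ hab
    rw [map_add, hy0, Derivation.leibniz, Derivation.leibniz_pow, pow_one, h11] at h'
    apply h1m
    rw [← h']
    simp only [smul_eq_mul, nsmul_eq_mul]
    refine add_mem (add_mem (Ideal.mul_mem_left _ _ ?_) ?_) (Ideal.mul_mem_right _ _ hy)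
    · simpa using Ideal.mul_mem_left _ _ hx
    · rw [pow_two, mul_assoc]
      exact Ideal.mul_mem_right _ _ hx
  have hnot2 : x ^ 2 ∉ Ideal.span {x ^ 3, y} := by
    intro h
    obtain ⟨a, b, hab⟩ := Ideal.mem_span_pair.mp h
    have e₁ : D₁ (a * x ^ 3) = x ^ 2 * (3 * a + x * D₁ a) := by
      rw [Derivation.leibniz, Derivation.leibniz_pow, h11, smul_eq_mul, nsmul_eq_mul, smul_eq_mul]
      push_cast
      ring
    have e₂ : ∀ c, D₁ (x ^ 2 * c) = x * (2 * c + x * D₁ c) := by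
      intro c
      rw [Derivation.leibniz, Derivation.leibniz_pow, h11, smul_eq_mul, nsmul_eq_mul, smul_eq_mul]
      push_cast
      ring
    have e₃ : D₁ (x ^ 2) = x + x := by
      rw [pow_two, Derivation.leibniz, h11, smul_eq_mul, mul_one]
    have h' := congrArg D₁ (congrArg D₁ hab)
    rw [map_add, hy0, e₁, map_add, e₂, e₃, map_add D₁ x x, h11, Derivation.leibniz, h12, smul_zero,
      add_zero, smul_eq_mul] at h'
    apply h1m
    refine Ideal.mem_of_intCast_mul_mem k 2 two_ne_zero ?_
    rw [Int.cast_ofNat, mul_one, ← one_add_one_eq_two, ← h']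
    exact add_mem (Ideal.mul_mem_right _ _ hx) (Ideal.mul_mem_right _ _ hy)
  have h2 := IsLocalRing.length_quotient_eq_add_one (hsup 2) hnot2 (hmul 2)
  have h1 := IsLocalRing.length_quotient_eq_add_one (hsup 1) hnot1 (hmul 1)
  have hnot0 : x ^ 0 ∉ Ideal.span {x ^ 1, y} := by
    rwa [pow_zero, pow_one, ← hm]
  have h0 := IsLocalRing.length_quotient_eq_add_one (hsup 0) hnot0 (hmul 0)
  have htop : Ideal.span {x ^ 0, y} = ⊤ :=
    (Ideal.eq_top_iff_one _).mpr (Ideal.subset_span (by simp))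
  have hbot : Module.length O (O ⧸ Ideal.span {x ^ 0, y}) = 0 := by
    rw [Module.length_eq_zero_iff, htop]
    exact Ideal.Quotient.subsingleton_iff.mpr rfl
  rw [h2, h1, h0, hbot]
  norm_num

end Length

/-! ### The local ring of the plane and its derivations. -/

section PlaneLocalRing

open MvPolynomial

theorem MvPolynomial.sub_C_eval_mem_span {σ R : Type*} [CommRing R] (q : σ → R)
    (p : MvPolynomial σ R) :
    p - C (eval q p) ∈ Ideal.span (Set.range fun j => X j - C (q j)) := by
  induction p using MvPolynomial.induction_on with
  | C a => simp
  | add p r hp hr =>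
    have : p + r - C (eval q (p + r)) = (p - C (eval q p)) + (r - C (eval q r)) := by
      rw [map_add, map_add]; ring
    rw [this]
    exact add_mem hp hr
  | mul_X p j hp =>
    have : p * X j - C (eval q (p * X j)) =
        X j * (p - C (eval q p)) + C (eval q p) * (X j - C (q j)) := by
      rw [map_mul, map_mul, eval_X]; ring
    rw [this]
    exact add_mem (Ideal.mul_mem_left _ _ hp) (Ideal.mul_mem_left _ _ (Ideal.subset_span ⟨j, rfl⟩))

theorem pointIdeal_eq_span (i : Fin 3) (q : Fin 3 → ℂ) :
    pointIdeal i q = Ideal.span {X 0 - C (i.removeNth q 0), X 1 - C (i.removeNth q 1)} := by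
  have hr : Set.range (fun j : Fin 2 => (X j - C (i.removeNth q j) : MvPolynomial (Fin 2) ℂ)) =
      {X 0 - C (i.removeNth q 0), X 1 - C (i.removeNth q 1)} := by
    ext p
    simp [Fin.exists_fin_two, eq_comm]
  apply le_antisymm
  · intro p hp
    have := MvPolynomial.sub_C_eval_mem_span (i.removeNth q) p
    rw [show eval (i.removeNth q) p = 0 from hp, C_0, sub_zero, hr] at this
    exact this
  · rw [Ideal.span_le]
    rintro p (rfl | rfl) <;> simp [pointIdeal, RingHom.mem_ker]

/-- The affine coordinates of the chart of index `i`, centred at `q`, in the local ring at `q`. -/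
noncomputable def localCoord (i : Fin 3) (q : Fin 3 → ℂ) (j : Fin 2) : PlaneLocalRing i q :=
  algebraMap (MvPolynomial (Fin 2) ℂ) (PlaneLocalRing i q) (X j - C (i.removeNth q j))

theorem PlaneLocalRing.maximalIdeal_eq (i : Fin 3) (q : Fin 3 → ℂ) :
    IsLocalRing.maximalIdeal (PlaneLocalRing i q) =
      Ideal.span {localCoord i q 0,
        localCoord i q 1} := by
  have h : IsLocalRing.maximalIdeal (PlaneLocalRing i q) =
      (pointIdeal i q).map (algebraMap _ (PlaneLocalRing i q)) :=
    (IsLocalization.AtPrime.map_eq_maximalIdeal (pointIdeal i q) (PlaneLocalRing i q)).symm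
  rw [h, pointIdeal_eq_span, Ideal.map_span, Set.image_pair]
  rfl

theorem PlaneLocalRing.exists_isPartialDerivatives (i : Fin 3) (q : Fin 3 → ℂ) :
    ∃ D₀ D₁ : Derivation ℂ (PlaneLocalRing i q) (PlaneLocalRing i q),
      IsPartialDerivatives (localCoord i q 0)
        (localCoord i q 1) D₀ D₁ ∧
      ∀ D : Derivation ℂ (PlaneLocalRing i q) (PlaneLocalRing i q),
        D = D (localCoord i q 0) • D₀
          + D (localCoord i q 1) • D₁ := by
  obtain ⟨D₀, h₀⟩ := Derivation.exists_of_isLocalization (S := PlaneLocalRing i q)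
    (pointIdeal i q).primeCompl (pderiv (R := ℂ) (0 : Fin 2))
  obtain ⟨D₁, h₁⟩ := Derivation.exists_of_isLocalization (S := PlaneLocalRing i q)
    (pointIdeal i q).primeCompl (pderiv (R := ℂ) (1 : Fin 2))
  refine ⟨D₀, D₁, ⟨PlaneLocalRing.maximalIdeal_eq i q, ?_, ?_, ?_, ?_⟩, fun D => ?_⟩
  · simp [localCoord, h₀]
  · simp [localCoord, h₀]
  · simp [localCoord, h₁]
  · simp [localCoord, h₁]
  · refine Derivation.ext_of_isLocalization (R := MvPolynomial (Fin 2) ℂ)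
      (pointIdeal i q).primeCompl fun p => ?_
    have hC : ∀ (D : Derivation ℂ (PlaneLocalRing i q) (PlaneLocalRing i q)) (c : ℂ),
        D (algebraMap (MvPolynomial (Fin 2) ℂ) (PlaneLocalRing i q) (C c)) = 0 := by
      intro D c
      have : algebraMap (MvPolynomial (Fin 2) ℂ) (PlaneLocalRing i q) (C c) =
          algebraMap ℂ _ c := (IsScalarTower.algebraMap_apply _ _ _ c).symm
      rw [this, Derivation.map_algebraMap]
    induction p using MvPolynomial.induction_on with
    | C a => rw [hC, hC]
    | add p r hp hr => rw [map_add, map_add, map_add, hp, hr]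
    | mul_X p j hp =>
      rw [map_mul, Derivation.leibniz, Derivation.leibniz, hp]
      congr 2
      fin_cases j <;> simp [localCoord, h₀, h₁, hC]

end PlaneLocalRing

/-! ### A line and the absolute conic as local parameters. -/

section LinearForms

open MvPolynomial

/-- The linear form with the given coefficients. -/
noncomputable def linForm {R : Type*} [CommRing R] (v : Fin 3 → R) : MvPolynomial (Fin 3) R :=
  ∑ j, C (v j) * X j

theorem eval_linForm {R : Type*} [CommRing R] (v q : Fin 3 → R) :
    eval q (linForm v) = v ⬝ᵥ q := by
  simp [linForm, dotProduct]

theorem eval_absoluteForm {R : Type*} [CommRing R] (q : Fin 3 → R) :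
    eval q (absoluteForm R) = q ⬝ᵥ q := by
  simp [absoluteForm, dotProduct, pow_two]

theorem map_linForm {R S : Type*} [CommRing R] [CommRing S] (φ : R →+* S) (v : Fin 3 → R) :
    MvPolynomial.map φ (linForm v) = linForm (φ ∘ v) := by
  simp [linForm]

theorem map_absoluteForm {R S : Type*} [CommRing R] [CommRing S] (φ : R →+* S) :
    MvPolynomial.map φ (absoluteForm R) = absoluteForm S := by
  simp [absoluteForm]

theorem germ_C (i : Fin 3) (q : Fin 3 → ℂ) (c : ℂ) :
    germ i q (C c) = algebraMap ℂ (PlaneLocalRing i q) c := by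
  change algebraMap (MvPolynomial (Fin 2) ℂ) (PlaneLocalRing i q) (dehomogenize i (C c)) = _
  rw [← algebraMap_eq, AlgHom.commutes, ← IsScalarTower.algebraMap_apply]

theorem germ_X_self (i : Fin 3) (q : Fin 3 → ℂ) : germ i q (X i) = 1 := by
  change algebraMap (MvPolynomial (Fin 2) ℂ) (PlaneLocalRing i q) (dehomogenize i (X i)) = _
  simp [dehomogenize]

theorem germ_X_succAbove (i : Fin 3) (q : Fin 3 → ℂ) (j : Fin 2) :
    germ i q (X (i.succAbove j)) =
      localCoord i q j + algebraMap ℂ (PlaneLocalRing i q) (q (i.succAbove j)) := by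
  rw [IsScalarTower.algebraMap_apply ℂ (MvPolynomial (Fin 2) ℂ) (PlaneLocalRing i q), localCoord,
    ← map_add]
  change algebraMap (MvPolynomial (Fin 2) ℂ) (PlaneLocalRing i q)
    (dehomogenize i (X (i.succAbove j))) = _
  simp [dehomogenize, Fin.removeNth, algebraMap_eq]

/-- A germ is invertible if the form does not vanish at the point. -/
theorem isUnit_germ {i : Fin 3} {q : Fin 3 → ℂ} (hq : q i = 1) {f : MvPolynomial (Fin 3) ℂ}
    (hf : eval q f ≠ 0) : IsUnit (germ i q f) := by
  refine IsLocalization.map_units (M := (pointIdeal i q).primeCompl) (PlaneLocalRing i q)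
    ⟨dehomogenize i f, fun h => hf ?_⟩
  have h' : eval (i.removeNth q) (dehomogenize i f) = 0 := h
  rw [← h', dehomogenize, ← aeval_eq_eval, ← aeval_eq_eval, ← AlgHom.comp_apply, comp_aeval]
  congr 2
  funext j
  refine Fin.succAboveCases i ?_ (fun j => ?_) j <;> simp [hq, Fin.removeNth]

/-- The tangent of the conic at `q` has coefficient vector proportional to `q`, which is isotropic.
As `v` is not isotropic, the line is transversal to the conic at `q`. -/
theorem maximalIdeal_eq_span_germ {i : Fin 3} {q : Fin 3 → ℂ} (hq : q i = 1) (hA : q ⬝ᵥ q = 0)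
    {v : Fin 3 → ℂ} (hv : v ⬝ᵥ q = 0) (hvv : v ⬝ᵥ v ≠ 0) :
    IsLocalRing.maximalIdeal (PlaneLocalRing i q) =
      Ideal.span {germ i q (linForm v), germ i q (absoluteForm ℂ)} := by
  simp only [dotProduct, Fin.sum_univ_succAbove _ i, Fin.sum_univ_two, hq, mul_one] at hA hv hvv
  set q₀ := q (i.succAbove 0) with hq₀
  set q₁ := q (i.succAbove 1) with hq₁
  set v₀ := v (i.succAbove 0) with hv₀
  set v₁ := v (i.succAbove 1) with hv₁
  set y₀ := localCoord i q 0 with hy₀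
  set y₁ := localCoord i q 1 with hy₁
  have hd : q₀ * v₁ - q₁ * v₀ ≠ 0 := by
    intro hd
    have h₁ : v₁ = q₁ * v i := by linear_combination -q₁ * hv + v₁ * hA - q₀ * hd
    have h₀ : v₀ = q₀ * v i := by linear_combination -q₀ * hv + v₀ * hA + q₁ * hd
    apply hvv
    rw [h₀, h₁]
    linear_combination v i ^ 2 * hA
  have hm := PlaneLocalRing.maximalIdeal_eq i q
  rw [← hy₀, ← hy₁] at hm
  set φ := algebraMap ℂ (PlaneLocalRing i q) with hφ
  have hL : germ i q (linForm v) = φ v₀ * y₀ + φ v₁ * y₁ := by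
    simp only [linForm, map_add, map_mul, germ_C, Fin.sum_univ_succAbove _ i, Fin.sum_univ_two,
      germ_X_self, germ_X_succAbove, ← hv₀, ← hv₁, ← hq₀, ← hq₁, ← hy₀, ← hy₁, ← hφ]
    have := congrArg φ hv
    simp only [map_add, map_mul, map_zero] at this
    linear_combination this
  have hAg : germ i q (absoluteForm ℂ) = (2 * φ q₀ + y₀) * y₀ + (2 * φ q₁ + y₁) * y₁ := by
    simp only [absoluteForm, map_add, map_pow, Fin.sum_univ_succAbove _ i, Fin.sum_univ_two,
      germ_X_self, germ_X_succAbove, ← hq₀, ← hq₁, ← hy₀, ← hy₁, ← hφ]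
    have := congrArg φ hA
    simp only [map_add, map_mul, map_zero, map_one] at this
    linear_combination this
  have hy₀m : y₀ ∈ IsLocalRing.maximalIdeal (PlaneLocalRing i q) :=
    hm ▸ Ideal.subset_span (by simp)
  have hy₁m : y₁ ∈ IsLocalRing.maximalIdeal (PlaneLocalRing i q) :=
    hm ▸ Ideal.subset_span (by simp)
  have hΔ : IsUnit ((2 * φ q₀ + y₀) * φ v₁ - (2 * φ q₁ + y₁) * φ v₀) := by
    by_contra h
    have h' : (2 * φ q₀ + y₀) * φ v₁ - (2 * φ q₁ + y₁) * φ v₀ ∈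
        IsLocalRing.maximalIdeal (PlaneLocalRing i q) := h
    have h2 : φ (2 * (q₀ * v₁ - q₁ * v₀)) ∈ IsLocalRing.maximalIdeal (PlaneLocalRing i q) := by
      have : φ (2 * (q₀ * v₁ - q₁ * v₀)) = ((2 * φ q₀ + y₀) * φ v₁ - (2 * φ q₁ + y₁) * φ v₀)
          - (φ v₁ * y₀ - φ v₀ * y₁) := by
        simp only [map_sub, map_mul, map_ofNat]
        ring
      rw [this]
      exact sub_mem h' (sub_mem (Ideal.mul_mem_left _ _ hy₀m) (Ideal.mul_mem_left _ _ hy₁m))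
    exact h2 ((isUnit_iff_ne_zero.mpr (mul_ne_zero two_ne_zero hd)).map φ)
  rw [hL, hAg]
  apply le_antisymm
  · rw [hm, Ideal.span_le]
    rintro z (rfl | rfl)
    · refine (Ideal.unit_mul_mem_iff_mem _ hΔ).mp (Ideal.mem_span_pair.mpr
        ⟨-(2 * φ q₁ + y₁), φ v₁, by ring⟩)
    · refine (Ideal.unit_mul_mem_iff_mem _ hΔ).mp (Ideal.mem_span_pair.mpr
        ⟨2 * φ q₀ + y₀, -φ v₀, by ring⟩)
  · rw [Ideal.span_le]
    rintro z (rfl | rfl) <;>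
      exact add_mem (Ideal.mul_mem_left _ _ hy₀m) (Ideal.mul_mem_left _ _ hy₁m)

end LinearForms

/-! ### Discriminant and contour of the cuspidal quartic. -/

section CuspidalQuartic

open MvPolynomial

/-- The quartic form `(A + L w + k w²)² + (M + e w) w³`, where `L` and `M` are linear forms with
coefficients `ℓ` and `m`. -/
noncomputable def cuspidalQuartic {R : Type*} [CommRing R] (ℓ m : Fin 3 → R) (k e : R) :
    MvPolynomial (Fin 4) R :=
  (rename Fin.succ (absoluteForm R) + rename Fin.succ (linForm ℓ) * X 0 + C k * X 0 ^ 2) ^ 2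
    + (rename Fin.succ (linForm m) + C e * X 0) * X 0 ^ 3

theorem eval_rename_succ {R : Type*} [CommRing R] (p : Fin 4 → R) (f : MvPolynomial (Fin 3) R) :
    eval p (rename Fin.succ f) = eval (Fin.tail p) f := by
  rw [eval_rename]; rfl

theorem pderiv_zero_rename_succ {R : Type*} [CommRing R] (f : MvPolynomial (Fin 3) R) :
    pderiv 0 (rename Fin.succ f : MvPolynomial (Fin 4) R) = 0 := by
  induction f using MvPolynomial.induction_on with
  | C a => simp
  | add p q hp hq => simp [hp, hq]
  | mul_X p j hp => simp [hp]

theorem eval_cuspidalQuartic {R : Type*} [CommRing R] (ℓ m : Fin 3 → R) (k e : R)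
    (p : Fin 4 → R) :
    eval p (cuspidalQuartic ℓ m k e) =
      (Fin.tail p ⬝ᵥ Fin.tail p + ℓ ⬝ᵥ Fin.tail p * p 0 + k * p 0 ^ 2) ^ 2
        + (m ⬝ᵥ Fin.tail p + e * p 0) * p 0 ^ 3 := by
  simp [cuspidalQuartic, eval_rename_succ, eval_linForm, eval_absoluteForm]

theorem eval_pderiv_cuspidalQuartic {R : Type*} [CommRing R] (ℓ m : Fin 3 → R) (k e : R)
    (p : Fin 4 → R) :
    eval p (pderiv 0 (cuspidalQuartic ℓ m k e)) =
      2 * (Fin.tail p ⬝ᵥ Fin.tail p + ℓ ⬝ᵥ Fin.tail p * p 0 + k * p 0 ^ 2)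
          * (ℓ ⬝ᵥ Fin.tail p + 2 * k * p 0)
        + (3 * m ⬝ᵥ Fin.tail p + 4 * e * p 0) * p 0 ^ 2 := by
  simp only [cuspidalQuartic, Derivation.leibniz, Derivation.leibniz_pow, map_add,
    pderiv_zero_rename_succ, pderiv_X_self, pderiv_C, smul_eq_mul, nsmul_eq_mul, map_mul, map_pow,
    eval_X, eval_C, eval_rename_succ, eval_linForm, eval_absoluteForm, map_zero, map_one,
    map_natCast]
  push_cast
  ring

theorem asPolynomialInW_cuspidalQuartic (ℓ m : Fin 3 → ℂ) (k e : ℂ) :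
    asPolynomialInW (cuspidalQuartic ℓ m k e) =
      quartic (absoluteForm ℂ ^ 2) (2 * absoluteForm ℂ * linForm ℓ)
        (linForm ℓ ^ 2 + 2 * C k * absoluteForm ℂ) (2 * C k * linForm ℓ + linForm m)
        (C k ^ 2 + C e) := by
  have hC : ∀ c : ℂ, finSuccEquiv ℂ 3 (C c) = Polynomial.C (C c) :=
    fun c => ((finSuccEquiv ℂ 3).symm_apply_eq.mp
      (RingHom.congr_fun (finSuccEquiv_comp_C_eq_C 3) c)).symm
  have hr : ∀ f : MvPolynomial (Fin 3) ℂ, finSuccEquiv ℂ 3 (rename Fin.succ f) =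
      Polynomial.C f := by
    intro f
    induction f using MvPolynomial.induction_on with
    | C a => rw [rename_C, hC]
    | add p q hp hq => simp [hp, hq]
    | mul_X p j hp => simp [hp, finSuccEquiv_X_succ]
  simp only [asPolynomialInW, cuspidalQuartic, quartic, map_add, map_mul, map_pow, hr, hC,
    finSuccEquiv_X_zero, map_ofNat]
  ring

theorem apparentContour_cuspidalQuartic {ℓ m : Fin 3 → ℂ} {k e : ℂ} (h : k ^ 2 + e ≠ 0) :
    apparentContour (cuspidalQuartic ℓ m k e) =
      cuspDiscr (absoluteForm ℂ) (linForm ℓ) (linForm m) (C k) (C e) * absoluteForm ℂ ^ 3 := by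
  -- The coefficient of `w⁴` is the value at `o`; it must not vanish for the degree to be four.
  have h4 : (C k ^ 2 + C e : MvPolynomial (Fin 3) ℂ) ≠ 0 := by
    rwa [← C_pow, ← C_add, Ne, C_eq_zero]
  rw [apparentContour, asPolynomialInW_cuspidalQuartic]
  have hcoeff : ∀ f₀ f₁ f₂ f₃ f₄ : MvPolynomial (Fin 3) ℂ,
      (quartic f₀ f₁ f₂ f₃ f₄).coeff 0 = f₀ ∧ (quartic f₀ f₁ f₂ f₃ f₄).coeff 1 = f₁ ∧
      (quartic f₀ f₁ f₂ f₃ f₄).coeff 2 = f₂ ∧ (quartic f₀ f₁ f₂ f₃ f₄).coeff 3 = f₃ ∧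
      (quartic f₀ f₁ f₂ f₃ f₄).coeff 4 = f₄ := by
    intro f₀ f₁ f₂ f₃ f₄
    simp [quartic, Polynomial.coeff_X, Polynomial.coeff_C, Polynomial.coeff_X_pow]
  have hdeg : ∀ {f₀ f₁ f₂ f₃ f₄ : MvPolynomial (Fin 3) ℂ}, f₄ ≠ 0 →
      (quartic f₀ f₁ f₂ f₃ f₄).natDegree = 4 := by
    intro f₀ f₁ f₂ f₃ f₄ hf
    refine Polynomial.natDegree_eq_of_le_of_coeff_ne_zero ?_ ?_
    · rw [quartic]
      compute_degree
    · rwa [(hcoeff f₀ f₁ f₂ f₃ f₄).2.2.2.2]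
  obtain ⟨h0, h1, h2, h3, h4'⟩ := hcoeff (absoluteForm ℂ ^ 2) (2 * absoluteForm ℂ * linForm ℓ)
        (linForm ℓ ^ 2 + 2 * C k * absoluteForm ℂ) (2 * C k * linForm ℓ + linForm m)
        (C k ^ 2 + C e)
  rw [discr_of_natDegree_eq_four (hdeg h4) h4' h3 h2 h1 h0, cuspDiscr]
  ring

/-- The contour meets the absolute conic, outside its embedded part, only where one of the linear
forms vanishes. -/
theorem linForm_eq_zero_of_mem_residualContour {ℓ m : Fin 3 → ℂ} {k e : ℂ} {p : Fin 4 → ℂ}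
    (hp : p ∈ absoluteConic ∩ residualContour (cuspidalQuartic ℓ m k e)) :
    m ⬝ᵥ Fin.tail p = 0 ∨ ℓ ⬝ᵥ Fin.tail p = 0 := by
  obtain ⟨⟨-, hp0, -⟩, -, hp⟩ := hp
  -- With `B = A + Lw + kw²`, the contour satisfies `B² = -(M + ew)w³` and `2B(L + 2kw) = -(3M +
  -- 4ew)w²`. Squaring the second equation, inserting the first and dividing by `w³` yields this
  -- polynomial; at `w = 0` it equals `4 M L²`.
  have h := hp (X 0 * (3 * rename Fin.succ (linForm m) + 4 * C e * X 0) ^ 2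
    + 4 * (rename Fin.succ (linForm m) + C e * X 0)
      * (rename Fin.succ (linForm ℓ) + 2 * C k * X 0) ^ 2) ?_
  · simp only [map_add, map_mul, map_pow, eval_X, eval_C, hp0, eval_rename_succ, eval_linForm,
      map_ofNat] at h
    have h' : (m ⬝ᵥ Fin.tail p) * (ℓ ⬝ᵥ Fin.tail p) ^ 2 = 0 := by linear_combination h / 4
    simpa using h'
  · rintro r ⟨⟨hr, h1, h2⟩, h3⟩
    rw [eval_cuspidalQuartic] at h1
    rw [eval_pderiv_cuspidalQuartic] at h2
    have hr0 : r 0 ≠ 0 := by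
      intro h0
      refine h3 ⟨hr, h0, ?_⟩
      rw [eval_absoluteForm]
      rw [h0] at h1
      simpa using h1
    simp only [map_add, map_mul, map_pow, eval_X, eval_C, eval_rename_succ, eval_linForm,
      map_ofNat]
    refine (mul_eq_zero.mp ?_).resolve_left (pow_ne_zero 3 hr0)
    set A := Fin.tail r ⬝ᵥ Fin.tail r
    set L := ℓ ⬝ᵥ Fin.tail r
    set M := m ⬝ᵥ Fin.tail r
    linear_combination 4 * (L + 2 * k * r 0) ^ 2 * h1
      + ((3 * M + 4 * e * r 0) * r 0 ^ 2 - 2 * (A + L * r 0 + k * r 0 ^ 2) * (L + 2 * k * r 0)) * h2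

end CuspidalQuartic

/-! ### Local analysis on the absolute conic. -/

theorem map_cuspDiscr {R S : Type*} [CommRing R] [CommRing S] (φ : R →+* S) (a l m k e : R) :
    φ (cuspDiscr a l m k e) = cuspDiscr (φ a) (φ l) (φ m) (φ k) (φ e) := by
  simp only [cuspDiscr, map_add, map_sub, map_mul, map_pow, map_ofNat]

/-- Substituting `m w` for `w` in the quartic with data `m² a, m l, m` gives `m⁴` times the quartic
with data `a, l, 1`. This reduces to `m = 1` wherever `M` is a unit. -/
theorem cuspDiscr_scale {R : Type*} [CommRing R] (a l m k e : R) :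
    cuspDiscr (m ^ 2 * a) (m * l) m k e = m ^ 6 * cuspDiscr a l 1 k e := by
  simp only [cuspDiscr]
  ring

/-- The restriction to the conic shows both contact orders: simple where only `m` vanishes (if `e ≠
0`), triple where only `l` does. -/
theorem exists_cuspDiscr_eq_tangent {R : Type*} [CommRing R] (a l m k e : R) :
    ∃ b, cuspDiscr a l m k e =
      l ^ 3 * m * (4 * (m ^ 2 + 4 * k * l * m - 4 * e * l ^ 2)) + b * a := by
  refine ⟨-27 * m ^ 4 - 144 * l * m ^ 3 * k + 120 * l ^ 2 * m ^ 2 * e - 128 * l ^ 2 * m ^ 2 * k ^ 2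
    + 128 * l ^ 3 * m * k * e + 16 * l ^ 4 * e ^ 2 + 288 * a * m ^ 2 * k * e
    + 256 * a * m ^ 2 * k ^ 3 - 384 * a * l * m * e ^ 2 - 256 * a * l * m * k ^ 2 * e
    - 128 * a * l ^ 2 * k * e ^ 2 + 256 * a ^ 2 * e ^ 3 + 256 * a ^ 2 * k ^ 2 * e ^ 2, ?_⟩
  rw [cuspDiscr]
  ring

theorem quarticSubresLin_scale {R : Type*} [CommRing R] (a l m k e : R) :
    quarticSubresLin ((m ^ 2 * a) ^ 2) (2 * (m ^ 2 * a) * (m * l))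
      ((m * l) ^ 2 + 2 * k * (m ^ 2 * a)) (2 * k * (m * l) + m) (k ^ 2 + e) =
    m ^ 7 * cuspLin a l k e := by
  simp only [cuspLin, quarticSubresLin]
  ring

theorem quarticSubresConst_scale {R : Type*} [CommRing R] (a l m k e : R) :
    quarticSubresConst ((m ^ 2 * a) ^ 2) (2 * (m ^ 2 * a) * (m * l))
      ((m * l) ^ 2 + 2 * k * (m ^ 2 * a)) (2 * k * (m * l) + m) (k ^ 2 + e) =
    m ^ 8 * cuspConst a l k e := by
  simp only [cuspConst, quarticSubresConst]
  ring

theorem Ideal.span_pair_unit_mul {R : Type*} [CommRing R] {u v : R} (hu : IsUnit u)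
    (hv : IsUnit v) (x y : R) : Ideal.span {u * x, v * y} = Ideal.span {x, y} := by
  rw [Ideal.span_insert, Ideal.span_insert, Ideal.span_singleton_mul_left_unit hu,
    Ideal.span_singleton_mul_left_unit hv]

theorem Ideal.span_pair_mul_unit_add {R : Type*} [CommRing R] {u : R} (hu : IsUnit u) (x y b : R) :
    Ideal.span {x * u + b * y, y} = Ideal.span {x, y} := by
  rw [Ideal.span_pair_comm, Ideal.span_pair_add_mul_left, Ideal.span_pair_comm, mul_comm, Ideal.span_insert, Ideal.span_insert,
    Ideal.span_singleton_mul_left_unit hu]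

section

variable {ℓ m : Fin 3 → ℂ} {k e : ℂ} {i : Fin 3} {q : Fin 3 → ℂ}

open MvPolynomial

theorem germ_cuspDiscr (i : Fin 3) (q : Fin 3 → ℂ) :
    germ i q (cuspDiscr (absoluteForm ℂ) (linForm ℓ) (linForm m) (C k) (C e)) =
      cuspDiscr (germ i q (absoluteForm ℂ)) (germ i q (linForm ℓ)) (germ i q (linForm m))
        (algebraMap ℂ _ k) (algebraMap ℂ _ e) := by
  rw [map_cuspDiscr, germ_C, germ_C]

/-- At a point of the absolute conic on the line `M = 0`, the reduced discriminant curve is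
transversal to the conic. -/
theorem intersectionMultiplicity_of_dotProduct_eq_zero (hq : q i = 1) (hA : q ⬝ᵥ q = 0)
    (hm : m ⬝ᵥ q = 0) (hmm : m ⬝ᵥ m ≠ 0) (hℓ : ℓ ⬝ᵥ q ≠ 0) (he : e ≠ 0) :
    intersectionMultiplicity i q
      (cuspDiscr (absoluteForm ℂ) (linForm ℓ) (linForm m) (C k) (C e)) (absoluteForm ℂ) = 1 := by
  obtain ⟨b, hb⟩ := exists_cuspDiscr_eq_tangent (absoluteForm ℂ) (linForm ℓ) (linForm m) (C k) (C e)
  have hu : IsUnit (germ i q (linForm ℓ ^ 3 * (4 * (linForm m ^ 2 + 4 * C k * linForm ℓ * linForm m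
      - 4 * C e * linForm ℓ ^ 2)))) := by
    apply isUnit_germ hq
    simp only [map_mul, map_add, map_sub, map_pow, eval_linForm, eval_C, hm, map_ofNat]
    have : (ℓ ⬝ᵥ q) ^ 3 * (4 * (0 ^ 2 + 4 * k * (ℓ ⬝ᵥ q) * 0 - 4 * e * (ℓ ⬝ᵥ q) ^ 2)) =
        -16 * e * (ℓ ⬝ᵥ q) ^ 5 := by ring
    rw [this]
    exact mul_ne_zero (mul_ne_zero (by norm_num) he) (pow_ne_zero _ hℓ)
  have h : germ i q (cuspDiscr (absoluteForm ℂ) (linForm ℓ) (linForm m) (C k) (C e)) =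
      germ i q (linForm m) * germ i q (linForm ℓ ^ 3 * (4 * (linForm m ^ 2
        + 4 * C k * linForm ℓ * linForm m - 4 * C e * linForm ℓ ^ 2)))
        + germ i q b * germ i q (absoluteForm ℂ) := by
    rw [← map_mul, ← map_mul, ← map_add]
    exact congrArg _ (hb.trans (by ring))
  have hspan : Ideal.span {germ i q (cuspDiscr (absoluteForm ℂ) (linForm ℓ) (linForm m) (C k) (C e)),
      germ i q (absoluteForm ℂ)} = IsLocalRing.maximalIdeal (PlaneLocalRing i q) := by
    rw [maximalIdeal_eq_span_germ hq hA hm hmm, h, Ideal.span_pair_mul_unit_add hu]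
  rw [intersectionMultiplicity, hspan, Module.length_eq_one_iff, isSimpleModule_iff_isCoatom]
  exact Ideal.isMaximal_def.mp (IsLocalRing.maximalIdeal.isMaximal _)

/-- At a point of the absolute conic on the line `L = 0`, the reduced discriminant curve meets the
conic with multiplicity three. -/
theorem intersectionMultiplicity_of_dotProduct_eq_zero' (hq : q i = 1) (hA : q ⬝ᵥ q = 0)
    (hℓ : ℓ ⬝ᵥ q = 0) (hℓℓ : ℓ ⬝ᵥ ℓ ≠ 0) (hm : m ⬝ᵥ q ≠ 0) :
    intersectionMultiplicity i q
      (cuspDiscr (absoluteForm ℂ) (linForm ℓ) (linForm m) (C k) (C e)) (absoluteForm ℂ) = 3 := by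
  obtain ⟨b, hb⟩ := exists_cuspDiscr_eq_tangent (absoluteForm ℂ) (linForm ℓ) (linForm m) (C k) (C e)
  have hu : IsUnit (germ i q (linForm m * (4 * (linForm m ^ 2 + 4 * C k * linForm ℓ * linForm m
      - 4 * C e * linForm ℓ ^ 2)))) := by
    apply isUnit_germ hq
    simp only [map_mul, map_add, map_sub, map_pow, eval_linForm, eval_C, hℓ, map_ofNat]
    have : (m ⬝ᵥ q) * (4 * ((m ⬝ᵥ q) ^ 2 + 4 * k * 0 * (m ⬝ᵥ q) - 4 * e * 0 ^ 2)) =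
        4 * (m ⬝ᵥ q) ^ 3 := by ring
    rw [this]
    exact mul_ne_zero (by norm_num) (pow_ne_zero _ hm)
  obtain ⟨D₀, D₁, hD, hspan⟩ := PlaneLocalRing.exists_isPartialDerivatives i q
  obtain ⟨E₁, E₂, hE, -⟩ := hD.exists_of_maximalIdeal_eq hspan
    (maximalIdeal_eq_span_germ hq hA hℓ hℓℓ)
  have h : germ i q (cuspDiscr (absoluteForm ℂ) (linForm ℓ) (linForm m) (C k) (C e)) =
      germ i q (linForm ℓ) ^ 3 * germ i q (linForm m * (4 * (linForm m ^ 2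
        + 4 * C k * linForm ℓ * linForm m - 4 * C e * linForm ℓ ^ 2)))
        + germ i q b * germ i q (absoluteForm ℂ) := by
    rw [← map_pow, ← map_mul, ← map_mul, ← map_add]
    exact congrArg _ (hb.trans (by ring))
  rw [intersectionMultiplicity, h, Ideal.span_pair_mul_unit_add hu,
    hE.length_quotient_span_pow_three]

theorem comap_conductorIdeal_eq_mixedJacobianIdeal (hq : q i = 1) (hA : q ⬝ᵥ q = 0)
    (hℓ : ℓ ⬝ᵥ q = 0) (hℓℓ : ℓ ⬝ᵥ ℓ ≠ 0) (hm : m ⬝ᵥ q ≠ 0) {G : MvPolynomial (Fin 4) ℂ}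
    (hGc : G = cuspidalQuartic ℓ m k e) (hG : G.IsHomogeneous 4) (ho : eval center G ≠ 0) :
    (conductorIdeal (localProjection G hG ho i q)).comap (Ideal.Quotient.mk _) =
      mixedJacobianIdeal
        (Ideal.span {germ i q (cuspDiscr (absoluteForm ℂ) (linForm ℓ) (linForm m) (C k) (C e))})
        (Ideal.span {germ i q (absoluteForm ℂ)}) (-9 : ℂ)
        (IsLocalRing.maximalIdeal (PlaneLocalRing i q) ^ 2) := by
  have hμ : IsUnit (germ i q (linForm m)) := isUnit_germ hq (by rwa [eval_linForm])
  obtain ⟨ν, hν⟩ := hμ.exists_left_inv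
  set μ := germ i q (linForm m) with hμ'
  obtain ⟨l, hl⟩ : ∃ l, germ i q (linForm ℓ) = μ * l :=
    ⟨ν * germ i q (linForm ℓ), by linear_combination -germ i q (linForm ℓ) * hν⟩
  obtain ⟨a, ha⟩ : ∃ a, germ i q (absoluteForm ℂ) = μ ^ 2 * a :=
    ⟨ν ^ 2 * germ i q (absoluteForm ℂ),
      by linear_combination -germ i q (absoluteForm ℂ) * (ν * μ + 1) * hν⟩
  have hmax := maximalIdeal_eq_span_germ hq hA hℓ hℓℓ
  rw [hl, ha, Ideal.span_pair_unit_mul hμ (hμ.pow 2)] at hmax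
  obtain ⟨D₀, D₁, hD, hspan⟩ := PlaneLocalRing.exists_isPartialDerivatives i q
  obtain ⟨E₁, E₂, hE, hJ⟩ := hD.exists_of_maximalIdeal_eq hspan hmax
  have hf : localEquation G i q =
      quartic ((μ ^ 2 * a) ^ 2) (2 * (μ ^ 2 * a) * (μ * l))
        ((μ * l) ^ 2 + 2 * algebraMap ℂ _ k * (μ ^ 2 * a)) (2 * algebraMap ℂ _ k * (μ * l) + μ)
        (algebraMap ℂ _ k ^ 2 + algebraMap ℂ _ e) := by
    rw [localEquation, hGc, asPolynomialInW_cuspidalQuartic, map_quartic]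
    simp only [map_add, map_mul, map_pow, map_ofNat, germ_C, hl, ha, ← hμ']
  have h4 : IsUnit (4 : PlaneLocalRing i q) := by
    have := (isUnit_iff_ne_zero.mpr (by norm_num : (4 : ℂ) ≠ 0)).map
      (algebraMap ℂ (PlaneLocalRing i q))
    rwa [map_ofNat] at this
  -- At `q`, where `L = A = 0`, the coefficient of `w³` is `M(q)` and the leading coefficient of the
  -- quadratic subresultant is `-3 M(q)²`.
  have hf₃ : IsUnit (2 * algebraMap ℂ (PlaneLocalRing i q) k * (μ * l) + μ) := by
    have := isUnit_germ hq (f := 2 * C k * linForm ℓ + linForm m) (by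
      simp only [map_add, map_mul, eval_linForm, hℓ]
      simpa using hm)
    simpa only [map_add, map_mul, map_ofNat, germ_C, hl, ← hμ'] using this
  have hu : IsUnit (8 * (algebraMap ℂ (PlaneLocalRing i q) k ^ 2 + algebraMap ℂ _ e)
      * ((μ * l) ^ 2 + 2 * algebraMap ℂ _ k * (μ ^ 2 * a))
      - 3 * (2 * algebraMap ℂ _ k * (μ * l) + μ) ^ 2) := by
    have := isUnit_germ hq (f := 8 * (C k ^ 2 + C e) * (linForm ℓ ^ 2 + 2 * C k * absoluteForm ℂ)
      - 3 * (2 * C k * linForm ℓ + linForm m) ^ 2) (by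
      simp only [map_add, map_sub, map_mul, map_pow, eval_linForm, eval_absoluteForm, hℓ, hA]
      simpa using hm)
    simpa only [map_add, map_sub, map_mul, map_pow, map_ofNat, germ_C, hl, ha, ← hμ'] using this
  rw [localProjection, comap_conductorIdeal_criticalMap_quartic h4 hf₃ hu hf,
    quarticSubresLin_scale, quarticSubresConst_scale,
    Ideal.span_pair_unit_mul (hμ.pow 7) (hμ.pow 8), ← mixedJacobianIdeal_cuspDiscr hE hJ k e,
    germ_cuspDiscr, hl, ha, ← hμ', cuspDiscr_scale,
    Ideal.span_singleton_mul_left_unit (hμ.pow 6), Ideal.span_singleton_mul_left_unit (hμ.pow 2)]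

end

/-! ### The equation forced by cuspidal plane sections. -/

section Cusps

open MvPolynomial

/-- The restriction of a polynomial to a line through the origin collects the homogeneous
components. -/
theorem coeff_aeval_C_mul_X {σ R : Type*} [CommRing R] (f : MvPolynomial σ R) (s : σ → R) (n : ℕ) :
    (aeval (fun j => Polynomial.C (s j) * Polynomial.X) f : Polynomial R).coeff n =
      eval s (homogeneousComponent n f) := by
  induction f using MvPolynomial.induction_on' with
  | add p q hp hq => simp only [map_add, Polynomial.coeff_add, hp, hq]
  | monomial d a =>
    have h : (aeval (fun j => Polynomial.C (s j) * Polynomial.X) (monomial d a) : Polynomial R) =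
        Polynomial.C (eval s (monomial d a)) * Polynomial.X ^ d.degree := by
      rw [aeval_monomial, eval_monomial, Finsupp.prod, Finsupp.prod, Finsupp.degree]
      simp only [mul_pow, Finset.prod_mul_distrib, Finset.prod_pow_eq_pow_sum, map_mul, map_prod,
        map_pow, Polynomial.algebraMap_eq, mul_assoc]
      rfl
    rw [h, Polynomial.coeff_C_mul, Polynomial.coeff_X_pow, homogeneousComponent_of_mem
      (isHomogeneous_monomial a rfl)]
    split_ifs <;> simp_all

/-- The quadratic part of a plane section of the quartic `A² + 2 A L w + Q w²` at a point of the
absolute conic. -/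
theorem eval_homogeneousComponent_two_planeSection (ℓ : Fin 3 → ℂ) (Q : MvPolynomial (Fin 4) ℂ)
    {q : Fin 3 → ℂ} (hq : q ⬝ᵥ q = 0) (u v : Fin 4 → ℂ) (s : Fin 2 → ℂ) :
    eval s (homogeneousComponent 2 (planeSection
      (rename Fin.succ (absoluteForm ℂ) ^ 2
        + 2 * rename Fin.succ (absoluteForm ℂ) * rename Fin.succ (linForm ℓ) * X 0 + Q * X 0 ^ 2)
      (Fin.cons 0 q) u v)) =
    (2 * (s 0 * q ⬝ᵥ Fin.tail u + s 1 * q ⬝ᵥ Fin.tail v)) ^ 2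
      + 2 * (2 * (s 0 * q ⬝ᵥ Fin.tail u + s 1 * q ⬝ᵥ Fin.tail v)) * ℓ ⬝ᵥ q * (s 0 * u 0 + s 1 * v 0)
      + eval (Fin.cons 0 q) Q * (s 0 * u 0 + s 1 * v 0) ^ 2 := by
  set d : Fin 4 → ℂ := fun k => s 0 * u k + s 1 * v k with hd
  set p : Fin 4 → ℂ := Fin.cons 0 q with hp
  set ψ : MvPolynomial (Fin 4) ℂ →ₐ[ℂ] Polynomial ℂ :=
    aeval fun k => Polynomial.C (p k) + Polynomial.C (d k) * Polynomial.X with hψ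
  have hcomp : ∀ F : MvPolynomial (Fin 4) ℂ,
      (aeval (fun j => Polynomial.C (s j) * Polynomial.X) (planeSection F p u v) : Polynomial ℂ) =
        ψ F := by
    intro F
    rw [planeSection, ← AlgHom.comp_apply, comp_aeval]
    congr 2
    funext k
    simp only [map_add, map_mul, aeval_C, aeval_X, Polynomial.algebraMap_eq, hd]
    ring
  rw [← coeff_aeval_C_mul_X, hcomp]
  have hX : ψ (X 0) = Polynomial.C (d 0) * Polynomial.X := by
    simp [hψ, hp]
  have hL : ψ (rename Fin.succ (linForm ℓ)) =
      Polynomial.C (ℓ ⬝ᵥ q) + Polynomial.C (ℓ ⬝ᵥ Fin.tail d) * Polynomial.X := by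
    simp only [linForm, hψ, map_mul, rename_C, rename_X, aeval_C, aeval_X, hp,
      Fin.cons_succ, dotProduct, Fin.tail, Polynomial.algebraMap_eq, Fin.sum_univ_three, map_add]
    ring
  -- Since `q` lies on the conic, `A` restricted to the line has no constant term, so the whole
  -- equation is divisible by `X²`.
  have hA : ψ (rename Fin.succ (absoluteForm ℂ)) = Polynomial.X *
      (Polynomial.C (2 * q ⬝ᵥ Fin.tail d)
        + Polynomial.C (Fin.tail d ⬝ᵥ Fin.tail d) * Polynomial.X) := by
    have h0 := congrArg (Polynomial.C : ℂ → Polynomial ℂ) hq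
    simp only [dotProduct, Fin.sum_univ_three, map_add, map_mul, map_zero] at h0
    simp only [absoluteForm, hψ, map_mul, map_pow, rename_X, aeval_X, hp,
      Fin.cons_succ, dotProduct, Fin.tail, Fin.sum_univ_three, map_add, map_ofNat]
    linear_combination h0
  have hQ : (ψ Q).coeff 0 = eval p Q := by
    rw [Polynomial.coeff_zero_eq_eval_zero, ← Polynomial.coe_aeval_eq_eval, ← AlgHom.comp_apply,
      hψ, comp_aeval, ← aeval_eq_eval]
    congr 2
    funext k
    simp
  have hF : ψ (rename Fin.succ (absoluteForm ℂ) ^ 2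
        + 2 * rename Fin.succ (absoluteForm ℂ) * rename Fin.succ (linForm ℓ) * X 0 + Q * X 0 ^ 2) =
      Polynomial.X ^ 2 * ((Polynomial.C (2 * q ⬝ᵥ Fin.tail d)
        + Polynomial.C (Fin.tail d ⬝ᵥ Fin.tail d) * Polynomial.X) ^ 2
      + 2 * (Polynomial.C (2 * q ⬝ᵥ Fin.tail d)
        + Polynomial.C (Fin.tail d ⬝ᵥ Fin.tail d) * Polynomial.X)
        * (Polynomial.C (ℓ ⬝ᵥ q) + Polynomial.C (ℓ ⬝ᵥ Fin.tail d) * Polynomial.X)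
        * Polynomial.C (d 0) + ψ Q * Polynomial.C (d 0) ^ 2) := by
    simp only [map_add, map_mul, map_pow, map_ofNat, hX, hL, hA]
    ring
  have hdot : q ⬝ᵥ Fin.tail d = s 0 * q ⬝ᵥ Fin.tail u + s 1 * q ⬝ᵥ Fin.tail v := by
    simp only [dotProduct, Fin.tail, hd, Fin.sum_univ_three]
    ring
  rw [hF]
  refine (Polynomial.coeff_X_pow_mul _ 2 0).trans ?_
  rw [← hdot, show s 0 * u 0 + s 1 * v 0 = d 0 from rfl]
  simp [Polynomial.mul_coeff_zero, hQ, pow_two]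

/-- The parametrization of the conic `x² + y² + z² = 0`. -/
noncomputable def conicPoint (t : ℂ) : Fin 3 → ℂ := ![1 - t ^ 2, 2 * t, Complex.I * (1 + t ^ 2)]

theorem conicPoint_dotProduct_self (t : ℂ) : conicPoint t ⬝ᵥ conicPoint t = 0 := by
  simp only [conicPoint, dotProduct, Fin.sum_univ_three, Matrix.cons_val]
  linear_combination (1 + t ^ 2) ^ 2 * Complex.I_mul_I

/-- One vector that is orthogonal to no point of the parametrization: it provides a direction
transversal to the conic at all of them. -/
theorem conicPoint_dotProduct (t : ℂ) : conicPoint t ⬝ᵥ ![1, 0, -Complex.I] = 2 := by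
  simp only [conicPoint, dotProduct, Fin.sum_univ_three, Matrix.cons_val]
  linear_combination -(1 + t ^ 2) * Complex.I_mul_I

/-- In these coordinates the quadratic part is `16 s² + 8 (ℓ·q) s t + Q(q) t²`. It is a square, so
its discriminant `64 ((ℓ·q)² - Q(q))` vanishes. -/
theorem eval_eq_sq_of_hasCusp {ℓ : Fin 3 → ℂ} {Q : MvPolynomial (Fin 4) ℂ} {q : Fin 3 → ℂ}
    (hq : q ⬝ᵥ q = 0) {u v : Fin 4 → ℂ} (hu : u 0 = 0) (hv : v 0 = 1) (hqu : q ⬝ᵥ Fin.tail u = 2)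
    (hqv : q ⬝ᵥ Fin.tail v = 0)
    (h : HasCuspAtOrigin (planeSection (rename Fin.succ (absoluteForm ℂ) ^ 2
        + 2 * rename Fin.succ (absoluteForm ℂ) * rename Fin.succ (linForm ℓ) * X 0 + Q * X 0 ^ 2)
      (Fin.cons 0 q) u v)) :
    eval (Fin.cons 0 q) Q = (ℓ ⬝ᵥ q) ^ 2 := by
  obtain ⟨-, -, f, hf, -, h2, -⟩ := h
  have key := eval_homogeneousComponent_two_planeSection ℓ Q hq u v
  rw [h2, hu, hv, hqu, hqv] at key
  rw [← mem_homogeneousSubmodule, homogeneousSubmodule_one_eq_span_X,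
    Submodule.mem_span_range_iff_exists_fun] at hf
  obtain ⟨c, rfl⟩ := hf
  have k1 := key ![1, 0]
  have k2 := key ![0, 1]
  have k3 := key ![1, 1]
  simp only [Fin.sum_univ_two, map_pow, map_add, smul_eval, eval_X, Matrix.cons_val_zero,
    Matrix.cons_val_one] at k1 k2 k3
  ring_nf at k1 k2 k3
  have h3 : c 0 * c 1 = 4 * ℓ ⬝ᵥ q := by linear_combination (k3 - k1 - k2) / 2
  have h4 : 16 * (eval (Fin.cons 0 q) Q - (ℓ ⬝ᵥ q) ^ 2) = 0 := by
    linear_combination (-16 : ℂ) * k2 - c 1 ^ 2 * k1 + (c 0 * c 1 + 4 * ℓ ⬝ᵥ q) * h3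
  exact sub_eq_zero.mp ((mul_eq_zero.mp h4).resolve_left (by norm_num))

/-- If the absolute conic is a cuspidal curve of `A² + 2 A L w + Q w² = 0`, then `Q = L²` on it. -/
theorem IsCuspidalCurve.eval_conicPoint {ℓ : Fin 3 → ℂ} {Q : MvPolynomial (Fin 4) ℂ}
    (h : IsCuspidalCurve (rename Fin.succ (absoluteForm ℂ) ^ 2
        + 2 * rename Fin.succ (absoluteForm ℂ) * rename Fin.succ (linForm ℓ) * X 0 + Q * X 0 ^ 2)
      absoluteConic) (t : ℂ) :
    eval (Fin.cons 0 (conicPoint t)) Q = (ℓ ⬝ᵥ conicPoint t) ^ 2 := by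
  obtain ⟨-, H, hH, hcusp⟩ := h
  let γ : Fin 3 → Polynomial ℂ := ![1 - Polynomial.X ^ 2, 2 * Polynomial.X,
    Polynomial.C Complex.I * (1 + Polynomial.X ^ 2)]
  let g : Polynomial ℂ := aeval (Fin.cons 0 γ : Fin 4 → Polynomial ℂ) Q
    - (∑ j, Polynomial.C (ℓ j) * γ j) ^ 2
  have hγ : ∀ t j, (γ j).eval t = conicPoint t j := by
    intro t j
    fin_cases j <;> simp [γ, conicPoint]
  have hg : ∀ t, g.eval t = eval (Fin.cons 0 (conicPoint t)) Q - (ℓ ⬝ᵥ conicPoint t) ^ 2 := by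
    intro t
    have h1 : (aeval (Fin.cons 0 γ : Fin 4 → Polynomial ℂ) Q).eval t =
        eval (Fin.cons 0 (conicPoint t)) Q := by
      rw [← Polynomial.coe_aeval_eq_eval, ← AlgHom.comp_apply, comp_aeval, ← aeval_eq_eval]
      congr 2
      funext k
      refine Fin.cases ?_ (fun j => ?_) k
      · simp
      · simp [hγ]
    simp only [g, Polynomial.eval_sub, h1, Polynomial.eval_pow, Polynomial.eval_finsetSum,
      Polynomial.eval_mul, Polynomial.eval_C, hγ, dotProduct]
  suffices hg0 : g = 0 by
    rw [← sub_eq_zero, ← hg, hg0, Polynomial.eval_zero]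
  -- If `g ≠ 0`, it has finitely many roots. A generic plane avoids the corresponding points, yet
  -- its section has a cusp at another point of the conic, which forces a further root.
  by_contra hg0
  have hne : ∀ {f : MvPolynomial (Fin 4) ℂ} (n : Fin 4 → ℂ), eval n f ≠ 0 → f ≠ 0 := by
    rintro f n hf rfl
    simp at hf
  -- `K₁ ≠ 0` makes the equation for the parameter of an intersection point properly quadratic, `K₂
  -- ≠ 0` allows projection along `n'`, and `K₃ z ≠ 0` keeps the plane away from the point with
  -- parameter `z`.
  let K₁ : MvPolynomial (Fin 4) ℂ := -X 1 + C Complex.I * X 3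
  let K₂ : MvPolynomial (Fin 4) ℂ := rename Fin.succ (absoluteForm ℂ)
  let K₃ : ℂ → MvPolynomial (Fin 4) ℂ := fun z => rename Fin.succ (linForm (conicPoint z))
  have hK : H * K₁ * K₂ * ∏ z ∈ g.roots.toFinset, K₃ z ≠ 0 := by
    refine mul_ne_zero (mul_ne_zero (mul_ne_zero hH ?_) ?_) (Finset.prod_ne_zero_iff.mpr ?_)
    · exact hne ![0, 1, 0, 0] (by simp [K₁])
    · exact hne ![0, 1, 0, 0] (by
        simp [K₂, eval_rename_succ, eval_absoluteForm, dotProduct, Fin.sum_univ_three])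
    · intro z _
      refine hne (Fin.cons 0 ![1, 0, -Complex.I]) ?_
      rw [eval_rename_succ, eval_linForm, Fin.tail_cons, conicPoint_dotProduct]
      exact two_ne_zero
  obtain ⟨n, hn⟩ : ∃ n : Fin 4 → ℂ,
      eval n (H * K₁ * K₂ * ∏ z ∈ g.roots.toFinset, K₃ z) ≠ 0 := by
    by_contra! h
    exact hK (MvPolynomial.funext fun n => by rw [h, map_zero])
  simp only [map_mul, map_prod, mul_ne_zero_iff, Finset.prod_ne_zero_iff] at hn
  obtain ⟨⟨⟨hn1, hn2⟩, hn3⟩, hn4⟩ := hn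
  simp only [K₁, map_add, map_neg, map_mul, eval_X, eval_C] at hn2
  simp only [K₂, eval_rename_succ, eval_absoluteForm] at hn3
  simp only [K₃, eval_rename_succ, eval_linForm] at hn4
  set n' := Fin.tail n with hn'
  obtain ⟨t, ht⟩ : ∃ t, conicPoint t ⬝ᵥ n' = 0 := by
    obtain ⟨s, hs⟩ := IsAlgClosed.exists_pow_nat_eq
      (n 2 ^ 2 - (-n 1 + Complex.I * n 3) * (n 1 + Complex.I * n 3)) two_pos
    refine ⟨(-n 2 + s) / (-n 1 + Complex.I * n 3), ?_⟩
    have : conicPoint ((-n 2 + s) / (-n 1 + Complex.I * n 3)) ⬝ᵥ n' =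
        (-n 1 + Complex.I * n 3) * ((-n 2 + s) / (-n 1 + Complex.I * n 3)) ^ 2
          + 2 * n 2 * ((-n 2 + s) / (-n 1 + Complex.I * n 3)) + (n 1 + Complex.I * n 3) := by
      simp only [conicPoint, dotProduct, Fin.sum_univ_three, Matrix.cons_val, hn', Fin.tail]
      simp only [Fin.succ_zero_eq_one, Fin.succ_one_eq_two, show (2 : Fin 3).succ = 3 from rfl]
      ring
    rw [this]
    field_simp
    linear_combination hs
  set q := conicPoint t with hq
  have hqq : q ⬝ᵥ q = 0 := conicPoint_dotProduct_self t
  have hqr : q ⬝ᵥ ![1, 0, -Complex.I] = 2 := conicPoint_dotProduct t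
  set r : Fin 3 → ℂ := ![1, 0, -Complex.I] with hr
  -- Multiples of `n'` move `(0, r)` and `(1, 0)` into the plane; as `q·n' = 0`, the products with
  -- `q` do not change.
  set u : Fin 4 → ℂ := Fin.cons 0 (r - (n' ⬝ᵥ r / n' ⬝ᵥ n') • n') with hu
  set v : Fin 4 → ℂ := Fin.cons 1 (-(n 0 / n' ⬝ᵥ n') • n') with hv
  have hdot : ∀ (a : ℂ) (w : Fin 3 → ℂ), n ⬝ᵥ Fin.cons a w = n 0 * a + n' ⬝ᵥ w := by
    intro a w
    rw [dotProduct, Fin.sum_univ_succ]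
    simp [hn', Fin.tail, dotProduct]
  have hqu : q ⬝ᵥ Fin.tail u = 2 := by
    rw [hu, Fin.tail_cons, dotProduct_sub, dotProduct_smul, ht, hqr, smul_zero, sub_zero]
  have hqv : q ⬝ᵥ Fin.tail v = 0 := by
    rw [hv, Fin.tail_cons, dotProduct_smul, ht, smul_zero]
  have hq0 : q ≠ 0 := by
    rintro h0
    rw [h0, zero_dotProduct] at hqr
    norm_num at hqr
  have hn0 : n ≠ 0 := by
    rintro rfl
    simp at hn2
  refine hn4 t ?_ (by rw [← hq, ht])
  rw [Multiset.mem_toFinset, Polynomial.mem_roots hg0, Polynomial.IsRoot, hg, sub_eq_zero]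
  refine eval_eq_sq_of_hasCusp hqq (u := u) (v := v) rfl rfl hqu hqv
    (hcusp n hn0 hn1 (Fin.cons 0 q) ⟨?_, rfl, ?_⟩ ?_ u v ?_ ?_ ?_)
  · intro h0
    exact hq0 (by rw [← Fin.tail_cons (α := fun _ => ℂ) 0 q, h0]; rfl)
  · rw [Fin.tail_cons, eval_absoluteForm, hqq]
  · rw [hdot, dotProduct_comm, ht]
    simp
  · rw [hdot, dotProduct_sub, dotProduct_smul, smul_eq_mul, div_mul_cancel₀ _ hn3]
    simp
  · rw [hdot, dotProduct_smul, smul_eq_mul, neg_mul, div_mul_cancel₀ _ hn3]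
    simp
  · rw [Fintype.linearIndependent_iff]
    intro c hc
    simp only [Fin.sum_univ_three, Matrix.cons_val] at hc
    have h2 : c 2 = 0 := by simpa [hu, hv] using congrFun hc 0
    rw [h2, zero_smul, add_zero] at hc
    have hc' : c 0 • q + c 1 • Fin.tail u = 0 := by
      funext j
      simpa [Fin.tail] using congrFun hc j.succ
    have h1 : c 1 = 0 := by
      have := congrArg (fun w => q ⬝ᵥ w) hc'
      simpa [dotProduct_add, dotProduct_smul, hqq, hqu] using this
    rw [h1, zero_smul, add_zero] at hc'
    have h0 : c 0 = 0 := (smul_eq_zero.mp hc').resolve_right hq0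
    intro j
    fin_cases j
    · exact h0
    · exact h1
    · exact h2

end Cusps

/-! ### Normal form of the equation and translation. -/

section NormalForm

open MvPolynomial

theorem exists_eq_linForm {R : Type*} [CommRing R] {L : MvPolynomial (Fin 3) R}
    (hL : L.IsHomogeneous 1) : ∃ ℓ : Fin 3 → R, L = linForm ℓ := by
  rw [← mem_homogeneousSubmodule, homogeneousSubmodule_one_eq_span_X,
    Submodule.mem_span_range_iff_exists_fun] at hL
  obtain ⟨ℓ, rfl⟩ := hL
  exact ⟨ℓ, by simp [linForm, smul_eq_C_mul]⟩

theorem exists_eq_sum_of_isHomogeneous_two {σ R : Type*} [Fintype σ] [CommRing R]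
    {Q : MvPolynomial σ R} (hQ : Q.IsHomogeneous 2) :
    ∃ a : σ → σ → R, Q = ∑ i, ∑ j, C (a i j) * (X i * X j) := by
  rw [← mem_homogeneousSubmodule, ← homogeneousSubmodule_one_pow, pow_two] at hQ
  induction hQ using Submodule.mul_induction_on' with
  | mem_mul_mem f hf g hg =>
    rw [homogeneousSubmodule_one_eq_span_X, Submodule.mem_span_range_iff_exists_fun] at hf hg
    obtain ⟨a, rfl⟩ := hf
    obtain ⟨b, rfl⟩ := hg
    refine ⟨fun i j => a i * b j, ?_⟩
    rw [Finset.sum_mul_sum]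
    refine Finset.sum_congr rfl fun i _ => Finset.sum_congr rfl fun j _ => ?_
    rw [smul_eq_C_mul, smul_eq_C_mul, C_mul]
    ring
  | add f _ g _ hf hg =>
    obtain ⟨a, rfl⟩ := hf
    obtain ⟨b, rfl⟩ := hg
    refine ⟨fun i j => a i j + b i j, ?_⟩
    simp only [C_add, add_mul, Finset.sum_add_distrib]

theorem map_cuspidalQuartic {R S : Type*} [CommRing R] [CommRing S] (φ : R →+* S)
    (ℓ m : Fin 3 → R) (k e : R) :
    MvPolynomial.map φ (cuspidalQuartic ℓ m k e) =
      cuspidalQuartic (φ ∘ ℓ) (φ ∘ m) (φ k) (φ e) := by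
  simp [cuspidalQuartic, map_rename, map_linForm, map_absoluteForm]

/-- The translation that moves the camera position `c` to the origin. -/
theorem viewFrom_cuspidalQuartic (c ℓ m : Fin 3 → ℝ) (k e : ℝ) :
    viewFrom c (cuspidalQuartic ℓ m k e) =
      cuspidalQuartic (Complex.ofRealHom ∘ (ℓ + (2 : ℝ) • c)) (Complex.ofRealHom ∘ m)
        (Complex.ofRealHom (k + ℓ ⬝ᵥ c + c ⬝ᵥ c)) (Complex.ofRealHom (e + m ⬝ᵥ c)) := by
  rw [viewFrom, ← map_cuspidalQuartic]
  congr 1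
  simp only [cuspidalQuartic, absoluteForm, linForm, Fin.sum_univ_three, map_add, map_mul, map_pow,
    rename_X, rename_C, aeval_X, aeval_C, Fin.cons_succ, Fin.cons_zero, algebraMap_eq,
    dotProduct, Pi.add_apply, Pi.smul_apply, smul_eq_mul, map_ofNat]
  ring

/-- The equation of a Darboux cyclide of degree four that has the absolute conic as a cuspidal
curve. -/
theorem IsDarbouxCyclide.exists_eq_cuspidalQuartic {F : MvPolynomial (Fin 4) ℝ}
    (hF : IsDarbouxCyclide F)
    (hcusp : IsCuspidalCurve (MvPolynomial.map Complex.ofRealHom F) absoluteConic) :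
    ∃ (ℓ m : Fin 3 → ℝ) (k e : ℝ), F = cuspidalQuartic ℓ m k e := by
  obtain ⟨⟨L, Q, hL, hQ, rfl⟩, -⟩ := hF
  obtain ⟨ℓ, rfl⟩ := exists_eq_linForm hL
  obtain ⟨a, rfl⟩ := exists_eq_sum_of_isHomogeneous_two hQ
  have hev : ∀ t : ℂ, _ := IsCuspidalCurve.eval_conicPoint (ℓ := Complex.ofRealHom ∘ ℓ)
    (Q := MvPolynomial.map Complex.ofRealHom (∑ i, ∑ j, C (a i j) * (X i * X j))) (by
      simpa only [map_add, map_mul, map_pow, map_rename, map_absoluteForm, map_linForm, map_X,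
        map_ofNat] using hcusp)
  -- The points are `(1, 0, i)`, `(0, 2, 2i)`, `(2, 2i, 0)`. As the coefficients are real, real and
  -- imaginary parts show that `Q - L²` on `w = 0` has equal diagonal entries and no mixed terms.
  have h0 := hev 0
  have h1 := hev 1
  have h2 := hev Complex.I
  clear hev hcusp hL hQ
  simp only [Fin.sum_univ_succ (n := 3), map_add, map_mul, map_C, map_X, eval_C, eval_X,
    Fin.cons_zero, Fin.cons_succ, Fin.sum_univ_three, dotProduct, Function.comp_apply,
    conicPoint, Matrix.cons_val, Complex.ext_iff, Complex.I_sq] at h0 h1 h2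
  simp [pow_two] at h0 h1 h2
  obtain ⟨κ, hκ⟩ : ∃ κ, a 3 3 = 2 * κ + ℓ 2 ^ 2 := ⟨(a 3 3 - ℓ 2 ^ 2) / 2, by ring⟩
  -- On `w = 0` one has `Q = L² + 2κA`. The terms `2κ L w³` and `κ² w⁴` of `(A + Lw + κw²)²` are
  -- subtracted from the rest.
  refine ⟨ℓ, fun j => a 0 j.succ + a j.succ 0 - 2 * κ * ℓ j, κ, a 0 0 - κ ^ 2, ?_⟩
  have h11 : a 1 1 = 2 * κ + ℓ 0 ^ 2 := by linear_combination h0.1 + hκ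
  have h22 : a 2 2 = 2 * κ + ℓ 1 ^ 2 := by linear_combination h1.1 / 4 + hκ
  have h12 : a 1 2 = 2 * ℓ 0 * ℓ 1 - a 2 1 := by linear_combination h2.2 / 4
  have h13 : a 1 3 = 2 * ℓ 0 * ℓ 2 - a 3 1 := by linear_combination h0.2
  have h23 : a 2 3 = 2 * ℓ 1 * ℓ 2 - a 3 2 := by linear_combination h1.2 / 4
  simp only [cuspidalQuartic, absoluteForm, linForm, Fin.sum_univ_succ (n := 3), Fin.sum_univ_three,
    map_add, map_mul, map_pow, map_sub, rename_X, rename_C, Fin.succ_zero_eq_one,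
    Fin.succ_one_eq_two, Fin.reduceSucc, map_ofNat, hκ, h11, h22, h12, h13, h23]
  ring

/-- Without `M` the equation `B² + e w⁴` is a difference of two squares over `ℂ`. -/
theorem ne_zero_of_irreducible_cuspidalQuartic {ℓ m : Fin 3 → ℂ} {k e : ℂ}
    (h : Irreducible (cuspidalQuartic ℓ m k e)) : m ≠ 0 := by
  rintro rfl
  obtain ⟨z, hz⟩ := IsAlgClosed.exists_pow_nat_eq (-e) two_pos
  let B : MvPolynomial (Fin 4) ℂ :=
    rename Fin.succ (absoluteForm ℂ) + rename Fin.succ (linForm ℓ) * X 0 + C k * X 0 ^ 2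
  have hB : cuspidalQuartic ℓ 0 k e = (B + C z * X 0 ^ 2) * (B - C z * X 0 ^ 2) := by
    have h0 : linForm (0 : Fin 3 → ℂ) = 0 := by simp [linForm]
    have hz' := congrArg (C : ℂ → MvPolynomial (Fin 4) ℂ) hz
    rw [C_pow, C_neg] at hz'
    rw [cuspidalQuartic, h0, map_zero]
    linear_combination X 0 ^ 4 * hz'
  have hB0 : eval 0 B = 0 := by
    simp [B, absoluteForm]
  rw [eval_zero] at hB0
  rcases h.isUnit_or_isUnit hB with hu | hu <;> simpa [hB0] using hu.map constantCoeff

end NormalForm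

/-! ### Generic camera positions. -/

section GenericCamera

open MvPolynomial

/-- Let `n = u × v`. Then `(n·q)²` is the Gram determinant of `u, v, q`, hence zero, while `(n·n) q
= (n·q) n` and `n·n` is the Gram determinant of `u, v`. -/
theorem eq_zero_of_dotProduct_eq_zero {K : Type*} [Field K] {u v q : Fin 3 → K}
    (h : (u ⬝ᵥ u) * (v ⬝ᵥ v) - (u ⬝ᵥ v) ^ 2 ≠ 0) (hu : u ⬝ᵥ q = 0) (hv : v ⬝ᵥ q = 0)
    (hq : q ⬝ᵥ q = 0) : q = 0 := by
  simp only [dotProduct, Fin.sum_univ_three] at h hu hv hq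
  have hN : (u 1 * v 2 - u 2 * v 1) * q 0 + (u 2 * v 0 - u 0 * v 2) * q 1
      + (u 0 * v 1 - u 1 * v 0) * q 2 = 0 := by
    refine pow_eq_zero_iff two_ne_zero |>.mp ?_
    linear_combination ((u 0 * u 0 + u 1 * u 1 + u 2 * u 2) * (v 0 * v 0 + v 1 * v 1 + v 2 * v 2)
      - (u 0 * v 0 + u 1 * v 1 + u 2 * v 2) ^ 2) * hq
      - (u 0 * u 0 + u 1 * u 1 + u 2 * u 2) * (v 0 * q 0 + v 1 * q 1 + v 2 * q 2) * hv
      + 2 * (u 0 * v 0 + u 1 * v 1 + u 2 * v 2) * (v 0 * q 0 + v 1 * q 1 + v 2 * q 2) * hu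
      - (v 0 * v 0 + v 1 * v 1 + v 2 * v 2) * (u 0 * q 0 + u 1 * q 1 + u 2 * q 2) * hu
  funext j
  refine (mul_eq_zero.mp ?_).resolve_left h
  fin_cases j <;> simp only [Fin.zero_eta, Fin.mk_one, Fin.reduceFinMk]
  · linear_combination (u 1 * v 2 - u 2 * v 1) * hN
      + ((u 2 * v 0 - u 0 * v 2) * u 2 - (u 0 * v 1 - u 1 * v 0) * u 1) * hv
      - ((u 2 * v 0 - u 0 * v 2) * v 2 - (u 0 * v 1 - u 1 * v 0) * v 1) * hu
  · linear_combination (u 2 * v 0 - u 0 * v 2) * hN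
      + ((u 0 * v 1 - u 1 * v 0) * u 0 - (u 1 * v 2 - u 2 * v 1) * u 2) * hv
      - ((u 0 * v 1 - u 1 * v 0) * v 0 - (u 1 * v 2 - u 2 * v 1) * v 2) * hu
  · linear_combination (u 0 * v 1 - u 1 * v 0) * hN
      + ((u 1 * v 2 - u 2 * v 1) * u 1 - (u 2 * v 0 - u 0 * v 2) * u 0) * hv
      - ((u 1 * v 2 - u 2 * v 1) * v 1 - (u 2 * v 0 - u 0 * v 2) * v 0) * hu

/-- The camera positions that are generic for the surface `(A + L w + k w²)² + (M + e w) w³ = 0`. -/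
noncomputable def genericCamera (ℓ m : Fin 3 → ℝ) (k e : ℝ) : MvPolynomial (Fin 3) ℝ :=
  -- The factors are the value of the translated form at `o`, the translated `e`, and the Gram
  -- determinant of `m` and the translated `ℓ`. The last one keeps the lines `L = 0` and `M = 0`
  -- from meeting on the conic.
  ((C k + linForm ℓ + absoluteForm ℝ) ^ 2 + (C e + linForm m)) * (C e + linForm m)
    * (C (m ⬝ᵥ m) * (C (ℓ ⬝ᵥ ℓ) + 4 * linForm ℓ + 4 * absoluteForm ℝ)
      - (C (m ⬝ᵥ ℓ) + 2 * linForm m) ^ 2)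

theorem eval_genericCamera (c ℓ m : Fin 3 → ℝ) (k e : ℝ) :
    eval c (genericCamera ℓ m k e) =
      ((k + ℓ ⬝ᵥ c + c ⬝ᵥ c) ^ 2 + (e + m ⬝ᵥ c)) * (e + m ⬝ᵥ c)
        * ((m ⬝ᵥ m) * ((ℓ + (2 : ℝ) • c) ⬝ᵥ (ℓ + (2 : ℝ) • c)) - (m ⬝ᵥ (ℓ + (2 : ℝ) • c)) ^ 2) := by
  simp only [genericCamera, map_mul, map_add, map_sub, map_pow, eval_C, eval_linForm,
    eval_absoluteForm, map_ofNat, dotProduct_add, add_dotProduct, dotProduct_smul, smul_dotProduct,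
    dotProduct_comm c ℓ, smul_eq_mul]
  ring

theorem genericCamera_ne_zero (ℓ : Fin 3 → ℝ) {m : Fin 3 → ℝ} (hm : m ≠ 0) (k e : ℝ) :
    genericCamera ℓ m k e ≠ 0 := by
  have hmm : m ⬝ᵥ m ≠ 0 := fun h => hm (dotProduct_self_eq_zero.mp h)
  rw [genericCamera]
  refine mul_ne_zero (mul_ne_zero ?_ ?_) ?_ <;> intro h
  -- A monic quartic in `t` has fourth difference 24, so it cannot vanish at five consecutive
  -- integers.
  · have h' : ∀ t : ℝ, (k + ℓ 0 * t + t ^ 2) ^ 2 + (e + m 0 * t) = 0 := by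
      intro t
      have := congrArg (eval ![t, 0, 0]) h
      simpa [eval_linForm, eval_absoluteForm, dotProduct, Fin.sum_univ_three, pow_two t] using this
    have := h' (-2)
    have := h' (-1)
    have := h' 0
    have := h' 1
    have := h' 2
    linarith
  · have h0 := congrArg (eval 0) h
    have h1 := congrArg (eval m) h
    simp only [map_add, eval_C, eval_linForm, dotProduct_zero, map_zero, add_zero] at h0 h1
    rw [h0, zero_add] at h1
    exact hmm h1
  -- The camera is chosen with `ℓ + 2c` equal to the `j`-th unit vector; summing over `j` gives `2
  -- m·m = 0`.
  · have h' : ∀ j : Fin 3, m ⬝ᵥ m - m j ^ 2 = 0 := by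
      intro j
      have := congrArg (eval ((1 / 2 : ℝ) • (Pi.single j 1 - ℓ))) h
      simp only [map_mul, map_add, map_sub, map_pow, eval_C, eval_linForm, eval_absoluteForm,
        map_ofNat, map_zero, dotProduct_smul, smul_dotProduct, dotProduct_sub, sub_dotProduct,
        smul_eq_mul, dotProduct_single, single_dotProduct, Pi.smul_apply, Pi.sub_apply,
        Pi.single_eq_same, mul_one, one_mul] at this
      linear_combination this
    apply hmm
    have h0 := h' 0
    have h1 := h' 1
    have h2 := h' 2
    have h3 : m ⬝ᵥ m = m 0 ^ 2 + m 1 ^ 2 + m 2 ^ 2 := by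
      simp only [dotProduct, Fin.sum_univ_three]
      ring
    linarith

end GenericCamera

/-! ### The main theorem. -/

theorem mainTheorem2 (F : MvPolynomial (Fin 4) ℝ) (hF : IsDarbouxCyclide F)
    (hcusp : IsCuspidalCurve (MvPolynomial.map Complex.ofRealHom F) absoluteConic) :
    ∃ P : MvPolynomial (Fin 3) ℝ, P ≠ 0 ∧
      ∀ c : Fin 3 → ℝ, MvPolynomial.eval c P ≠ 0 →
        ∃ (ho : MvPolynomial.eval center (viewFrom c F) ≠ 0) (U₁ : MvPolynomial (Fin 3) ℂ),
          apparentContour (viewFrom c F) = U₁ * absoluteForm ℂ ^ 3 ∧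
          ∀ p ∈ absoluteConic ∩ residualContour (viewFrom c F),
            ∀ (i : Fin 3) (q : Fin 3 → ℂ), q = Fin.tail p → q i = 1 →
              2 ≤ intersectionMultiplicity i q U₁ (absoluteForm ℂ) →
              intersectionMultiplicity i q U₁ (absoluteForm ℂ) = 3 ∧
              (conductorIdeal (localProjection (viewFrom c F)
                  (hF.isHomogeneous_viewFrom c) ho i q)).comap (Ideal.Quotient.mk _) =
                mixedJacobianIdeal (Ideal.span {germ i q U₁})
                  (Ideal.span {germ i q (absoluteForm ℂ)}) (-9 : ℂ)
                  (IsLocalRing.maximalIdeal (PlaneLocalRing i q) ^ 2) := by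
  obtain ⟨ℓ, m, k, e, hFe⟩ := hF.exists_eq_cuspidalQuartic hcusp
  have hirr := hF.2
  rw [hFe, map_cuspidalQuartic] at hirr
  have hm : m ≠ 0 := by
    rintro rfl
    exact ne_zero_of_irreducible_cuspidalQuartic hirr (by ext; simp)
  refine ⟨genericCamera ℓ m k e, genericCamera_ne_zero ℓ hm k e, fun c hc => ?_⟩
  rw [eval_genericCamera, mul_ne_zero_iff, mul_ne_zero_iff] at hc
  have hv := viewFrom_cuspidalQuartic c ℓ m k e
  rw [← hFe] at hv
  have hdot : ∀ u v : Fin 3 → ℝ, (Complex.ofRealHom ∘ u) ⬝ᵥ (Complex.ofRealHom ∘ v) =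
      Complex.ofRealHom (u ⬝ᵥ v) := fun u v => (RingHom.map_dotProduct _ u v).symm
  have hne : ∀ {x : ℝ}, x ≠ 0 → Complex.ofRealHom x ≠ 0 := fun h => by simpa using h
  obtain ⟨⟨hke, he⟩, hgram⟩ := hc
  set ℓ' := ℓ + (2 : ℝ) • c with hℓ'
  set k' := k + ℓ ⬝ᵥ c + c ⬝ᵥ c
  set e' := e + m ⬝ᵥ c
  have hmm : m ⬝ᵥ m ≠ 0 := fun h => hm (dotProduct_self_eq_zero.mp h)
  have hℓℓ : ℓ' ⬝ᵥ ℓ' ≠ 0 := by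
    intro h
    rw [dotProduct_self_eq_zero.mp h] at hgram
    simp at hgram
  have hgram' := hne hgram
  simp only [map_sub, map_mul, map_pow, ← hdot] at hgram'
  have hke' := hne hke
  rw [map_add, map_pow] at hke'
  have ho : MvPolynomial.eval center (viewFrom c F) ≠ 0 := by
    have ht : Fin.tail center = 0 := by
      funext j
      simp [center, Fin.tail]
    rw [hv, eval_cuspidalQuartic, ht]
    simpa [center] using hke'
  refine ⟨ho, _, by rw [hv, apparentContour_cuspidalQuartic hke'], ?_⟩
  rintro p hp i q rfl hqi h2
  have hq : Fin.tail p ⬝ᵥ Fin.tail p = 0 := by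
    rw [← eval_absoluteForm]
    exact hp.1.2.2
  have hnot : ¬ ((Complex.ofRealHom ∘ m) ⬝ᵥ Fin.tail p = 0 ∧
      (Complex.ofRealHom ∘ ℓ') ⬝ᵥ Fin.tail p = 0) := by
    rintro ⟨h, h'⟩
    rw [eq_zero_of_dotProduct_eq_zero hgram' h h' hq] at hqi
    simp at hqi
  rw [hv] at hp
  -- Where `M` vanishes the multiplicity is one, against the assumed tangency; otherwise the contour
  -- condition forces `L = 0`.
  by_cases hm0 : (Complex.ofRealHom ∘ m) ⬝ᵥ Fin.tail p = 0
  · rw [intersectionMultiplicity_of_dotProduct_eq_zero hqi hq hm0 (hdot m m ▸ hne hmm)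
      (fun h => hnot ⟨hm0, h⟩) (hne he)] at h2
    norm_num at h2
  · have hℓ0 := (linForm_eq_zero_of_mem_residualContour hp).resolve_left hm0
    exact ⟨intersectionMultiplicity_of_dotProduct_eq_zero' hqi hq hℓ0 (hdot ℓ' ℓ' ▸ hne hℓℓ) hm0,
      comap_conductorIdeal_eq_mixedJacobianIdeal hqi hq hℓ0 (hdot ℓ' ℓ' ▸ hne hℓℓ) hm0 hv
        (hF.isHomogeneous_viewFrom c) ho⟩
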